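/- Let $0\le q<r$. For integers $n,p\ge 1$ and $R>0$ let $\mathcal G_q(R)$ be the set of real symmetric positive semidefinite $p\times p$ matrices $\Sigma=(\sigma_{ij})$ with $\sigma_{ii}=1$ for all $i$ and $\max_{i\le p}\sum_{j\le p}|\sigma_{ij}|^q\le R$ (for $q=0$ the sum counts the nonzero entries of row $i$), and let $\ell_r(\Sigma)=\max_{i\le p}\sum_{j\le p}|\sigma_{ij}|^r$. Let $R_0>1$, and assume $R_0\ge 2$ if $q=0$. Then there is a constant $C_4>0$, depending only on $q$, $r$ and $R_0$, such that for all $n,p$ and all $R\ge R_0$ with $2\log p<n$ and $R^2<(p-1)n^{-q}/2$, $$\inf_{\hat L}\ \sup_{\Sigma\in\mathcal G_q(R)}\mathbb E_\Sigma\big[(\hat L-\ell_r(\Sigma))^2\big]\ \ge\ C_4\left(R^2\,\frac{\log p}{n}\ \vee\ \left\{R^2\left(\frac{\log\big(\frac{p-1}{R^2n^q}+1\big)}{2n}\right)^{r-q}\wedge R^{2r/q}\wedge 1\right\}\right),$$ where the infimum is over all measurable real-valued functions $\hat L$ of the sample $X_1,\dots,X_n$, the expectation $\mathbb E_\Sigma$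 is for $X_1,\dots,X_n$ independent with law $\mathcal N(0,\Sigma)$ on $\mathbb R^p$, and $R^{2r/q}$ is read as $+\infty$ when $q=0$. -/

import Mathlib

open MeasureTheory ProbabilityTheory

noncomputable section

/-- `|x| ^ q` with the convention of `ℓ_q` balls for `q = 0`: `|x| ^ 0` is the indicator of
`x ≠ 0` (in Mathlib, `0 ^ 0 = 1`). For `q > 0` this is the usual power. -/
def absPow (q x : ℝ) : ℝ := if x = 0 then 0 else |x| ^ q

/-- The functional `ℓ_r(Σ) = max_i ∑_j |σ_ij| ^ r` of a `p × p` matrix. -/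
def ellFunctional {p : ℕ} (r : ℝ) (S : Matrix (Fin p) (Fin p) ℝ) : ℝ :=
  ⨆ i : Fin p, ∑ j : Fin p, absPow r (S i j)

/-- The class `𝒢_q(R)` of row-sparse `p × p` correlation matrices: positive semidefinite, unit
diagonal, and `∑_j |σ_ij| ^ q ≤ R` for every row `i` (the diagonal entry included). -/
def rowSparseClass (p : ℕ) (q R : ℝ) : Set (Matrix (Fin p) (Fin p) ℝ) :=
  {S | S.PosSemidef ∧ (∀ i, ∑ j, absPow q (S i j) ≤ R) ∧ ∀ i, S i i = 1}

/-- The law of the sample `(X_1, …, X_n)` of independent `N(0, Σ)` vectors in `ℝ^p`. -/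
def gaussianSample (n p : ℕ) (S : Matrix (Fin p) (Fin p) ℝ) :
    Measure (Fin n → EuclideanSpace ℝ (Fin p)) :=
  Measure.pi fun _ => multivariateGaussian 0 S

/-- The minimax squared risk `inf_L̂ sup_{Σ ∈ 𝒢_q(R)} 𝔼_Σ (L̂ - ℓ_r(Σ))²`, valued in `[0, ∞]`.
The infimum runs over all measurable real functions `L̂` of the sample. -/
def ellMinimaxRisk (n p : ℕ) (q r R : ℝ) : ENNReal :=
  ⨅ (L : (Fin n → EuclideanSpace ℝ (Fin p)) → ℝ) (_ : Measurable L),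
    ⨆ S ∈ rowSparseClass p q R,
      ∫⁻ X, ENNReal.ofReal ((L X - ellFunctional r S) ^ 2) ∂(gaussianSample n p S)

/-- The rate `R² log p / n ∨ {R² (log ((p-1)/(R² n^q) + 1) / (2n))^(r-q) ∧ R^(2r/q) ∧ 1}`.
For `q = 0` the term `R ^ (2 * r / q)` evaluates to `1`; because of the `∧ 1` this gives the
same value as the convention `R ^ (2r/0) = ∞` that is appropriate for `R > 1`. -/
def ellRate (n p : ℕ) (q r R : ℝ) : ℝ :=
  max (R ^ 2 * (Real.log p / n))
    (min (min
      (R ^ 2 * (Real.log (((p : ℝ) - 1) / (R ^ 2 * (n : ℝ) ^ q) + 1) / (2 * n)) ^ (r - q))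
      (R ^ (2 * r / q))) 1)

end

noncomputable section

/-! The proof is Le Cam's method: one null covariance against a uniform mixture of alternatives
whose functional exceeds the null value by at least `Δ`. If the mixture likelihood ratio has bounded
second moment, the risk is at least `Δ² / 32` (`le_ellMinimaxRisk_of_correlated`).

All likelihood ratios are computed on latent variables: independent standard normal parents and
children, with the children in a set `S` given correlation `δ` with one parent. The sample is a
fixed linear image of these, so it may have a singular covariance. Given a parent value `x`, each
common child of two alternatives contributes at most `exp (δ² (1 + x²))` to the second moment. With
many common children this need not be integrable in `x`, so each likelihood ratio is truncated to
the event `moderateParent` that the parent has empirical second moment at most `4`. This costs a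
quarter of the mass and leaves the bound `exp (5 n δ² |S ∩ S'|)` for a pair of alternatives.

Two designs give the two terms of the rate. For `R² log p / n`, variables form pairs of groups of `m
≍ R` identical copies, with correlation `b` between the groups of a pair; an alternative raises this
correlation in one pair by `(1 - b) δ`, where `δ² ≍ log p / n` (`le_ellMinimaxRisk_of_pairs`). There
are enough pairs for `log` of their number to be of order `log p`, and the gap is of order `m δ`.
For the sparse term the null is the identity, and an alternative gives one variable correlation `δ ≍
√τ` with `k ≍ R τ^(-q/2)` others, where `τ = log (u + 1) / (2 n)` and `u = (p - 1) / (R² n^q)`; the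
gap `k δ^r` is of order `R τ^((r - q)/2)` (`le_ellMinimaxRisk_of_star`). -/

/-! ### Densities on finite products of probability spaces. -/

theorem lintegral_pi_prod {ι : Type*} [Fintype ι] {X : ι → Type*} [∀ i, MeasurableSpace (X i)]
    (μ : ∀ i, Measure (X i)) [∀ i, IsProbabilityMeasure (μ i)] (f : ∀ i, X i → ENNReal)
    (hf : ∀ i, Measurable (f i)) :
    ∫⁻ x, ∏ i, f i (x i) ∂Measure.pi μ = ∏ i, ∫⁻ x, f i x ∂μ i := by
  refine (lintegral_prod_eq_prod_lintegral_of_indepFun Finset.univ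
    (fun i (x : ∀ i, X i) => f i (x i)) (iIndepFun_pi (fun i => (hf i).aemeasurable))
    (fun i => (hf i).comp (measurable_pi_apply i))).trans ?_
  refine Finset.prod_congr rfl fun i _ => ?_
  exact (measurePreserving_eval μ i).lintegral_comp (hf i)

theorem pi_withDensity {ι : Type*} [Fintype ι] {X : ι → Type*} [∀ i, MeasurableSpace (X i)]
    (μ : ∀ i, Measure (X i)) [∀ i, IsProbabilityMeasure (μ i)] (f : ∀ i, X i → ENNReal)
    (hf : ∀ i, Measurable (f i)) [∀ i, SigmaFinite ((μ i).withDensity (f i))] :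
    Measure.pi (fun i => (μ i).withDensity (f i)) =
      (Measure.pi μ).withDensity (fun x => ∏ i, f i (x i)) := by
  refine Measure.pi_eq fun s hs => ?_
  rw [withDensity_apply _ (MeasurableSet.univ_pi hs),
    ← lintegral_indicator (MeasurableSet.univ_pi hs)]
  have : (fun x => (Set.univ.pi s).indicator (fun x => ∏ i, f i (x i)) x) =
      fun x => ∏ i, (s i).indicator (f i) (x i) := by
    funext x
    by_cases hx : x ∈ Set.univ.pi s
    · rw [Set.indicator_of_mem hx]
      refine Finset.prod_congr rfl fun i _ => ?_
      rw [Set.indicator_of_mem (hx i (Set.mem_univ i))]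
    · rw [Set.indicator_of_notMem hx]
      simp only [Set.mem_pi, Set.mem_univ, true_implies, not_forall] at hx
      obtain ⟨i, hi⟩ := hx
      exact (Finset.prod_eq_zero (Finset.mem_univ i) (Set.indicator_of_notMem hi _)).symm
  rw [this, lintegral_pi_prod μ _ (fun i => (hf i).indicator (hs i))]
  refine Finset.prod_congr rfl fun i _ => ?_
  rw [lintegral_indicator (hs i), withDensity_apply _ (hs i)]

/-! ### The likelihood ratio of one correlated normal variable and its second moment. -/

/-- The density of `N(δ x, 1 - δ²)` with respect to `N(0, 1)`. -/
def corrDensity (δ x v : ℝ) : ENNReal :=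
  ENNReal.ofReal (gaussianPDFReal (δ * x) (1 - δ ^ 2).toNNReal v / gaussianPDFReal 0 1 v)

@[fun_prop]
theorem measurable_corrDensity (δ : ℝ) :
    Measurable fun z : ℝ × ℝ => corrDensity δ z.1 z.2 := by
  unfold corrDensity
  refine ENNReal.measurable_ofReal.comp (Measurable.div ?_ ?_)
  · exact measurable_uncurry_gaussianPDFReal.comp
      (f := fun z : ℝ × ℝ => (δ * z.1, (1 - δ ^ 2).toNNReal, z.2)) (by fun_prop)
  · exact (measurable_gaussianPDFReal 0 1).comp measurable_snd

theorem map_corr_gaussianReal {δ : ℝ} (hδ : δ ^ 2 < 1) (x : ℝ) :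
    (gaussianReal 0 1).map (fun v => δ * x + √(1 - δ ^ 2) * v) =
      (gaussianReal 0 1).withDensity (corrDensity δ x) := by
  have h1 : (fun v => δ * x + √(1 - δ ^ 2) * v) =
      (fun w => δ * x + w) ∘ (fun v => √(1 - δ ^ 2) * v) := rfl
  have hv : NNReal.mk (√(1 - δ ^ 2) ^ 2) (sq_nonneg _) * 1 = (1 - δ ^ 2).toNNReal := by
    ext
    simp [Real.sq_sqrt (by linarith : (0 : ℝ) ≤ 1 - δ ^ 2),
      Real.coe_toNNReal _ (by linarith : (0 : ℝ) ≤ 1 - δ ^ 2)]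
  have hv0 : (1 - δ ^ 2).toNNReal ≠ 0 := by
    rw [Ne, Real.toNNReal_eq_zero]; linarith
  rw [h1, ← Measure.map_map (by fun_prop) (by fun_prop), gaussianReal_map_const_mul,
    gaussianReal_map_const_add, hv, mul_zero, zero_add, gaussianReal_of_var_ne_zero _ hv0,
    gaussianReal_of_var_ne_zero _ one_ne_zero]
  have hm : Measurable (corrDensity δ x) := by
    have := (measurable_corrDensity δ).comp (measurable_prodMk_left (x := x)); exact this
  rw [← withDensity_mul _ (measurable_gaussianPDF 0 1) hm]
  congr 1
  funext v
  have h0 := gaussianPDFReal_pos 0 1 v one_ne_zero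
  simp only [Pi.mul_apply, corrDensity, gaussianPDF]
  rw [← ENNReal.ofReal_mul h0.le, mul_div_cancel₀ _ h0.ne']

/-- Follows from `(1 + 2t)(1 - t²) ≥ 1` on this interval. With `t = δ²` it absorbs the normalizing
factor `(1 - δ⁴)^(-1/2)` into `exp δ²`. -/
theorem one_sub_sq_ge_exp {t : ℝ} (h0 : 0 ≤ t) (h1 : t ≤ 1 / 2) :
    Real.exp (-(2 * t)) ≤ 1 - t ^ 2 := by
  rw [Real.exp_neg, inv_le_comm₀ (Real.exp_pos _) (by nlinarith)]
  refine le_trans ?_ (Real.add_one_le_exp (2 * t))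
  rw [inv_le_iff_one_le_mul₀ (by nlinarith)]
  nlinarith

/-- Completing the square: the quotient is again a Gaussian density up to a constant, so its
integral, the second moment of the likelihood ratio, is that constant. -/
theorem gaussianPDFReal_sq_eq {d μ v : ℝ} (h0 : 0 ≤ d) (h1 : d < 1) :
    gaussianPDFReal μ (1 - d).toNNReal v ^ 2 / gaussianPDFReal 0 1 v =
      √(1 - d ^ 2)⁻¹ * Real.exp (μ ^ 2 / (1 + d)) *
        gaussianPDFReal (2 * μ / (1 + d)) ((1 - d) / (1 + d)).toNNReal v := by
  have hp : (0 : ℝ) < 1 - d := by linarith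
  have hq : (0 : ℝ) < 1 + d := by linarith
  have hpi := Real.pi_pos
  simp only [gaussianPDFReal, Real.coe_toNNReal _ hp.le,
    Real.coe_toNNReal _ (div_pos hp hq).le, NNReal.coe_one, mul_one, sub_zero]
  rw [mul_pow, inv_pow, Real.sq_sqrt (by positivity), ← Real.exp_nat_mul]
  have hc : (2 * Real.pi * (1 - d))⁻¹ =
      √(1 - d ^ 2)⁻¹ * (√(2 * Real.pi * ((1 - d) / (1 + d))))⁻¹ * (√(2 * Real.pi))⁻¹ := by
    rw [← Real.sqrt_inv, ← Real.sqrt_inv, ← Real.sqrt_mul (by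
      have : 0 < 1 - d ^ 2 := by nlinarith
      positivity), ← Real.sqrt_mul (by
      have : 0 < 1 - d ^ 2 := by nlinarith
      positivity)]
    rw [eq_comm, Real.sqrt_eq_iff_mul_self_eq_of_pos (by positivity)]
    have : 1 - d ^ 2 = (1 - d) * (1 + d) := by ring
    rw [this]
    field_simp
  have he : ((2 : ℕ) : ℝ) * (-(v - μ) ^ 2 / (2 * (1 - d))) =
      μ ^ 2 / (1 + d) + (-(v - 2 * μ / (1 + d)) ^ 2 / (2 * ((1 - d) / (1 + d)))) + (-v ^ 2 / 2) := by
    field_simp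
    push_cast
    ring
  rw [hc, he, Real.exp_add, Real.exp_add]
  have := Real.exp_pos (-v ^ 2 / 2)
  field_simp

theorem lintegral_corrDensity_sq_le {δ : ℝ} (hδ : δ ^ 2 ≤ 1 / 2) (x : ℝ) :
    ∫⁻ v, corrDensity δ x v * corrDensity δ x v ∂gaussianReal 0 1 ≤
      ENNReal.ofReal (Real.exp (δ ^ 2 * (1 + x ^ 2))) := by
  have hd0 := sq_nonneg δ
  have hm : Measurable (corrDensity δ x) := by
    have := (measurable_corrDensity δ).comp (measurable_prodMk_left (x := x)); exact this
  rw [gaussianReal_of_var_ne_zero _ one_ne_zero,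
    lintegral_withDensity_eq_lintegral_mul (g := fun v => corrDensity δ x v * corrDensity δ x v) _
      (measurable_gaussianPDF 0 1) (hm.mul hm)]
  have : ∀ v, (gaussianPDF 0 1 * (fun v => corrDensity δ x v * corrDensity δ x v)) v =
      ENNReal.ofReal (√(1 - (δ ^ 2) ^ 2)⁻¹ * Real.exp ((δ * x) ^ 2 / (1 + δ ^ 2))) *
        gaussianPDF (2 * (δ * x) / (1 + δ ^ 2)) ((1 - δ ^ 2) / (1 + δ ^ 2)).toNNReal v := by
    intro v
    have h0 := gaussianPDFReal_pos 0 1 v one_ne_zero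
    have h2 := gaussianPDFReal_nonneg (δ * x) (1 - δ ^ 2).toNNReal v
    simp only [Pi.mul_apply, corrDensity, gaussianPDF]
    rw [← ENNReal.ofReal_mul (by positivity), ← ENNReal.ofReal_mul h0.le,
      ← ENNReal.ofReal_mul (by positivity), ← gaussianPDFReal_sq_eq hd0 (by linarith)]
    congr 1
    field_simp
  simp_rw [this]
  rw [lintegral_const_mul _ (measurable_gaussianPDF _ _), lintegral_gaussianPDF_eq_one, mul_one]
  swap
  · have : 0 < (1 - δ ^ 2) / (1 + δ ^ 2) := div_pos (by linarith) (by linarith)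
    simpa [Real.toNNReal_eq_zero] using this
  refine ENNReal.ofReal_le_ofReal ?_
  rw [mul_add, mul_one, Real.exp_add]
  gcongr
  · rw [Real.sqrt_le_iff]
    refine ⟨(Real.exp_pos _).le, ?_⟩
    rw [inv_le_comm₀ (by nlinarith) (by positivity), ← Real.exp_nat_mul, ← Real.exp_neg]
    exact_mod_cast one_sub_sq_ge_exp hd0 hδ
  · rw [mul_pow]
    exact div_le_self (by positivity) (by linarith)

/-! ### Latent parents and children, and the likelihood ratio of correlating them. -/

/-- The standard Gaussian measure on `ι → ℝ`. -/
abbrev stdNormal (ι : Type*) [Fintype ι] : Measure (ι → ℝ) :=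
  Measure.pi fun _ : ι => gaussianReal 0 1

/-- Independent standard normal parents (indexed by `Q`) and children (indexed by `C`). -/
abbrev latentGaussian (Q C : Type*) [Fintype Q] [Fintype C] : Measure ((Q → ℝ) × (C → ℝ)) :=
  (stdNormal Q).prod (stdNormal C)

/-- Correlates the children in `S` with the parent `q`, with correlation `δ`. -/
def correlate {Q C : Type*} [DecidableEq C] (δ : ℝ) (q : Q) (S : Finset C)
    (z : (Q → ℝ) × (C → ℝ)) : (Q → ℝ) × (C → ℝ) :=
  (z.1, fun c => if c ∈ S then δ * z.1 q + √(1 - δ ^ 2) * z.2 c else z.2 c)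

/-- The likelihood ratio of the law of `correlate δ q S`. -/
def correlateDensity {Q C : Type*} [Fintype C] [DecidableEq C]
    (δ : ℝ) (q : Q) (S : Finset C) (z : (Q → ℝ) × (C → ℝ)) : ENNReal :=
  ∏ c, if c ∈ S then corrDensity δ (z.1 q) (z.2 c) else 1

@[fun_prop]
theorem measurable_correlate {Q C : Type*} [DecidableEq C] (δ : ℝ) (q : Q) (S : Finset C) :
    Measurable (correlate δ q S) := by
  unfold correlate
  refine Measurable.prodMk measurable_fst (measurable_pi_lambda _ fun c => ?_)
  split_ifs <;> fun_prop

@[fun_prop]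
theorem measurable_correlateDensity {Q C : Type*} [Fintype C] [DecidableEq C]
    (δ : ℝ) (q : Q) (S : Finset C) :
    Measurable (correlateDensity δ q S) := by
  unfold correlateDensity
  refine Finset.measurable_fun_prod _ fun c _ => ?_
  split_ifs
  · exact (measurable_corrDensity δ).comp (f := fun z : (Q → ℝ) × (C → ℝ) => (z.1 q, z.2 c))
      (by fun_prop)
  · fun_prop

theorem measurable_corrDensity_right (δ x : ℝ) : Measurable (corrDensity δ x) := by
  have := (measurable_corrDensity δ).comp (measurable_prodMk_left (x := x))
  exact this

/-- Given the parents, the children are transformed coordinate by coordinate, so the one-dimensional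
change of measure `map_corr_gaussianReal` tensorizes. -/
theorem map_correlate {Q C : Type*} [Fintype Q] [Fintype C] [DecidableEq C]
    {δ : ℝ} (hδ : δ ^ 2 < 1) (q : Q) (S : Finset C) :
    (latentGaussian Q C).map (correlate δ q S) =
      (latentGaussian Q C).withDensity (correlateDensity δ q S) := by
  refine Measure.ext_of_lintegral _ fun H hH => ?_
  rw [lintegral_map hH (by fun_prop),
    lintegral_withDensity_eq_lintegral_mul _ (by fun_prop) hH,
    lintegral_prod _ (by fun_prop), lintegral_prod _ (by fun_prop)]
  refine lintegral_congr fun x => ?_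
  let T : C → ℝ → ℝ := fun c v => if c ∈ S then δ * x q + √(1 - δ ^ 2) * v else v
  let φ : C → ℝ → ENNReal := fun c v => if c ∈ S then corrDensity δ (x q) v else 1
  have hT : ∀ c, Measurable (T c) := fun c => by
    by_cases hc : c ∈ S <;> simp only [T, hc, if_true, if_false] <;> fun_prop
  have hφ : ∀ c, Measurable (φ c) := fun c => by
    by_cases hc : c ∈ S <;> simp only [φ, hc, if_true, if_false]
    · exact measurable_corrDensity_right _ _
    · fun_prop
  have hmap : ∀ c, (gaussianReal 0 1).map (T c) = (gaussianReal 0 1).withDensity (φ c) := by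
    intro c
    by_cases hc : c ∈ S <;> simp only [T, φ, hc, if_true, if_false]
    · exact map_corr_gaussianReal hδ _
    · rw [Measure.map_id']; exact withDensity_one.symm
  have hprob : ∀ c, IsProbabilityMeasure ((gaussianReal 0 1).map (T c)) := fun c =>
    Measure.isProbabilityMeasure_map (hT c).aemeasurable
  have hprob' : ∀ c, IsProbabilityMeasure ((gaussianReal 0 1).withDensity (φ c)) := fun c =>
    hmap c ▸ hprob c
  have hkey : (stdNormal C).map (fun v c => T c (v c)) =
      (stdNormal C).withDensity (fun v => ∏ c, φ c (v c)) := by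
    rw [← pi_withDensity _ _ hφ, Measure.pi_map_pi fun c => (hT c).aemeasurable]
    simp_rw [hmap]
  have hH' : Measurable fun v => H (x, v) := hH.comp measurable_prodMk_left
  have : ∫⁻ v, H (x, v) ∂((stdNormal C).map (fun v c => T c (v c))) =
      ∫⁻ v, H (x, v) ∂((stdNormal C).withDensity (fun v => ∏ c, φ c (v c))) := by rw [hkey]
  have hTm : Measurable fun (v : C → ℝ) c => T c (v c) :=
    measurable_pi_lambda _ fun c => (hT c).comp (measurable_pi_apply c)
  have hφm : Measurable fun v : C → ℝ => ∏ c, φ c (v c) :=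
    Finset.measurable_fun_prod _ fun c _ => (hφ c).comp (measurable_pi_apply c)
  rw [lintegral_map hH' hTm,
    lintegral_withDensity_eq_lintegral_mul _ hφm hH'] at this
  exact this

theorem lintegral_corrDensity {δ : ℝ} (hδ : δ ^ 2 < 1) (x : ℝ) :
    ∫⁻ v, corrDensity δ x v ∂gaussianReal 0 1 = 1 := by
  have : IsProbabilityMeasure ((gaussianReal 0 1).withDensity (corrDensity δ x)) := by
    rw [← map_corr_gaussianReal hδ]
    exact Measure.isProbabilityMeasure_map (by fun_prop)
  rw [← setLIntegral_univ, ← withDensity_apply _ MeasurableSet.univ, measure_univ]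

/-- Weighted second moment of a pair of likelihood ratios. The weight compensates the growth of
the conditional second moment in the common parent. -/
theorem lintegral_correlateDensity_mul_le {Q C : Type*} [Fintype Q] [Fintype C] [DecidableEq C]
    {δ : ℝ} (hδ : δ ^ 2 ≤ 1 / 2) (q q' : Q)
    (S S' : Finset C) (h : (S ∩ S').Nonempty → q = q') :
    ∫⁻ z, correlateDensity δ q S z * correlateDensity δ q' S' z *
        ENNReal.ofReal (Real.exp ((S ∩ S').card * δ ^ 2 * (4 - z.1 q ^ 2))) ∂latentGaussian Q C ≤
      ENNReal.ofReal (Real.exp (5 * δ ^ 2 * (S ∩ S').card)) := by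
  have hδ1 : δ ^ 2 < 1 := by linarith
  rw [lintegral_prod _ (by fun_prop)]
  refine (lintegral_mono (g := fun _ => ENNReal.ofReal (Real.exp (5 * δ ^ 2 * (S ∩ S').card)))
    fun x => ?_).trans_eq (by simp)
  have hm : Measurable fun v : C → ℝ =>
      correlateDensity δ q S (x, v) * correlateDensity δ q' S' (x, v) := by
    exact ((measurable_correlateDensity δ q S).mul
      (measurable_correlateDensity δ q' S')).comp measurable_prodMk_left
  dsimp only
  rw [lintegral_mul_const _ hm]
  have hE : ∀ v : C → ℝ, correlateDensity δ q S (x, v) * correlateDensity δ q' S' (x, v) =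
      ∏ c, ((if c ∈ S then corrDensity δ (x q) (v c) else 1) *
        (if c ∈ S' then corrDensity δ (x q') (v c) else 1)) := fun v => by
    simp only [correlateDensity, Finset.prod_mul_distrib]
  have hm1 : ∀ (c : C) (S : Finset C) (q : Q),
      Measurable fun v : ℝ => if c ∈ S then corrDensity δ (x q) v else 1 := by
    intro c S q
    by_cases hc : c ∈ S <;> simp only [hc, if_true, if_false]
    · exact measurable_corrDensity_right _ _
    · fun_prop
  simp_rw [hE]
  rw [lintegral_pi_prod (fun _ : C => gaussianReal 0 1)
    (fun c v => (if c ∈ S then corrDensity δ (x q) v else 1) *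
        (if c ∈ S' then corrDensity δ (x q') v else 1))
    (fun c => (hm1 c S q).mul (hm1 c S' q'))]
  -- Outside the overlap at most one factor is a density, which integrates to `1`. In the overlap
  -- both densities have the same parent, by `h`.
  have hle : ∀ c, ∫⁻ v, (if c ∈ S then corrDensity δ (x q) v else 1) *
        (if c ∈ S' then corrDensity δ (x q') v else 1) ∂gaussianReal 0 1 ≤
      if c ∈ S ∩ S' then ENNReal.ofReal (Real.exp (δ ^ 2 * (1 + x q ^ 2))) else 1 := by
    intro c
    by_cases hc : c ∈ S <;> by_cases hc' : c ∈ S' <;>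
      simp only [hc, hc', Finset.mem_inter, if_true, if_false, and_self, and_true, and_false,
        mul_one, one_mul, lintegral_corrDensity hδ1, lintegral_const,
        measure_univ, le_refl]
    obtain rfl : q = q' := h ⟨c, Finset.mem_inter.2 ⟨hc, hc'⟩⟩
    exact lintegral_corrDensity_sq_le hδ _
  refine (mul_le_mul_left (Finset.prod_le_prod' fun c _ => hle c) _).trans_eq ?_
  rw [Finset.prod_ite_mem, Finset.univ_inter, Finset.prod_const,
    ← ENNReal.ofReal_pow (Real.exp_pos _).le, ← ENNReal.ofReal_mul (by positivity),
    ← Real.exp_nat_mul, ← Real.exp_add]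
  -- The terms in `x q ^ 2` cancel: `m δ² (1 + x²) + m δ² (4 - x²) = 5 m δ²`, where `m` is the size
  -- of the overlap.
  congr 2
  ring

/-! ### Linear images of the latent variables and their covariance. -/

theorem integral_exp_mulVec_stdNormal {ι κ : Type*} [Fintype ι] [Fintype κ] (A : Matrix κ ι ℝ)
    (t : κ → ℝ) :
    ∫ x, Complex.exp (((A.mulVec x ⬝ᵥ t : ℝ) : ℂ) * Complex.I) ∂stdNormal ι =
      Complex.exp ((-(t ⬝ᵥ (A * A.transpose).mulVec t) / 2 : ℝ)) := by
  have h := charFun_stdGaussian (WithLp.toLp 2 (A.transpose.mulVec t))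
  rw [← map_pi_eq_stdGaussian, charFun_apply, integral_map (by fun_prop) (by fun_prop)] at h
  have hi : ∀ x : ι → ℝ, inner ℝ (WithLp.toLp 2 x) (WithLp.toLp 2 (A.transpose.mulVec t)) =
      A.mulVec x ⬝ᵥ t := fun x => by
    rw [EuclideanSpace.inner_toLp_toLp, star_trivial, Matrix.mulVec_transpose,
      dotProduct_comm (A.mulVec x), Matrix.dotProduct_mulVec]
  have hn : ‖WithLp.toLp 2 (A.transpose.mulVec t)‖ ^ 2 = t ⬝ᵥ (A * A.transpose).mulVec t := by
    rw [← real_inner_self_eq_norm_sq, hi, ← Matrix.mulVec_mulVec, dotProduct_comm]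
  simp_rw [hi] at h
  rw [h, ← Complex.ofReal_pow, hn]
  push_cast
  rfl

/-- Characteristic functions are compared rather than densities, because the covariance may be
singular. -/
theorem map_latentGaussian_mulVec {Q C : Type*} [Fintype Q] [Fintype C] {p : ℕ}
    (P : Matrix (Fin p) Q ℝ) (W : Matrix (Fin p) C ℝ) :
    (latentGaussian Q C).map (fun z => WithLp.toLp 2 (P.mulVec z.1 + W.mulVec z.2)) =
      multivariateGaussian 0 (P * P.transpose + W * W.transpose) := by
  have hpos : (P * P.transpose + W * W.transpose).PosSemidef := by
    have h1 := Matrix.posSemidef_self_mul_conjTranspose P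
    have h2 := Matrix.posSemidef_self_mul_conjTranspose W
    rw [Matrix.conjTranspose_eq_transpose_of_trivial] at h1 h2
    exact h1.add h2
  have hmeas : Measurable fun z : (Q → ℝ) × (C → ℝ) =>
      WithLp.toLp 2 (P.mulVec z.1 + W.mulVec z.2) := by
    refine Continuous.measurable ?_
    fun_prop
  have : IsProbabilityMeasure ((latentGaussian Q C).map
      (fun z => WithLp.toLp 2 (P.mulVec z.1 + W.mulVec z.2))) :=
    Measure.isProbabilityMeasure_map hmeas.aemeasurable
  refine Measure.ext_of_charFun ?_
  funext t
  rw [charFun_multivariateGaussian hpos, charFun_apply,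
    integral_map hmeas.aemeasurable (by fun_prop)]
  have he : ∀ z : (Q → ℝ) × (C → ℝ),
      Complex.exp ((inner ℝ (WithLp.toLp 2 (P.mulVec z.1 + W.mulVec z.2)) t : ℝ) * Complex.I) =
      Complex.exp (((P.mulVec z.1 ⬝ᵥ t.ofLp : ℝ) : ℂ) * Complex.I) *
        Complex.exp (((W.mulVec z.2 ⬝ᵥ t.ofLp : ℝ) : ℂ) * Complex.I) := fun z => by
    rw [← Complex.exp_add, ← add_mul, ← Complex.ofReal_add, ← add_dotProduct,
      EuclideanSpace.inner_eq_star_dotProduct, star_trivial, dotProduct_comm]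
  simp_rw [he]
  rw [integral_prod_mul (fun x => Complex.exp (((P.mulVec x ⬝ᵥ t.ofLp : ℝ) : ℂ) * Complex.I))
    (fun x => Complex.exp (((W.mulVec x ⬝ᵥ t.ofLp : ℝ) : ℂ) * Complex.I)),
    integral_exp_mulVec_stdNormal, integral_exp_mulVec_stdNormal, ← Complex.exp_add]
  congr 1
  rw [Matrix.add_mulVec, dotProduct_add]
  simp
  ring

/-- The covariance matrix of `P x + W v` after the children in `S` have been correlated with the
parent `q`. -/
def correlatedCov {Q C : Type*} [Fintype Q] [Fintype C] {p : ℕ} (P : Matrix (Fin p) Q ℝ)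
    (W : Matrix (Fin p) C ℝ) (δ : ℝ) (q : Q) (S : Finset C) : Matrix (Fin p) (Fin p) ℝ :=
  Matrix.of fun i j => ∑ q', P i q' * P j q' + ∑ c, W i c * W j c +
    δ * (P i q * ∑ c ∈ S, W j c + (∑ c ∈ S, W i c) * P j q) +
    -- Distinct children in `S` have covariance `δ²` through their common parent; the subtracted sum
    -- reflects that each child keeps variance `1`.
    δ ^ 2 * ((∑ c ∈ S, W i c) * (∑ c ∈ S, W j c) - ∑ c ∈ S, W i c * W j c)

/-- Loadings of the parents after correlating. -/
def correlatedParents {Q C : Type*} [DecidableEq Q] {p : ℕ} (P : Matrix (Fin p) Q ℝ)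
    (W : Matrix (Fin p) C ℝ) (δ : ℝ) (q : Q) (S : Finset C) : Matrix (Fin p) Q ℝ :=
  Matrix.of fun i q' => P i q' + if q' = q then δ * ∑ c ∈ S, W i c else 0

/-- Loadings of the children after correlating. -/
def correlatedChildren {C : Type*} [DecidableEq C] {p : ℕ}
    (W : Matrix (Fin p) C ℝ) (δ : ℝ) (S : Finset C) : Matrix (Fin p) C ℝ :=
  Matrix.of fun i c => W i c * if c ∈ S then √(1 - δ ^ 2) else 1

theorem correlatedCov_eq {Q C : Type*} [Fintype Q] [Fintype C] [DecidableEq Q] [DecidableEq C]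
    {p : ℕ} (P : Matrix (Fin p) Q ℝ) (W : Matrix (Fin p) C ℝ) {δ : ℝ} (hδ : δ ^ 2 ≤ 1) (q : Q)
    (S : Finset C) :
    correlatedParents P W δ q S * (correlatedParents P W δ q S).transpose +
      correlatedChildren W δ S * (correlatedChildren W δ S).transpose =
        correlatedCov P W δ q S := by
  ext i j
  have h1 : ∑ c, W i c * (if c ∈ S then √(1 - δ ^ 2) else 1) *
      (W j c * if c ∈ S then √(1 - δ ^ 2) else 1) =
      ∑ c, W i c * W j c - δ ^ 2 * ∑ c ∈ S, W i c * W j c := by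
    rw [Finset.mul_sum, ← Finset.univ_inter S, ← Finset.sum_ite_mem, ← Finset.sum_sub_distrib]
    refine Finset.sum_congr rfl fun c _ => ?_
    simp only [Finset.univ_inter]
    split_ifs
    · have := Real.mul_self_sqrt (by linarith : 0 ≤ 1 - δ ^ 2)
      linear_combination W i c * W j c * this
    · ring
  simp only [Matrix.add_apply, Matrix.mul_apply, Matrix.transpose_apply, correlatedParents,
    correlatedChildren, correlatedCov, Matrix.of_apply, h1]
  simp only [add_mul, mul_add, Finset.sum_add_distrib, ite_mul, mul_ite, zero_mul, mul_zero,
    Finset.sum_ite_eq',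
    Finset.mem_univ, if_true]
  ring

theorem mulVec_correlate {Q C : Type*} [Fintype Q] [Fintype C] [DecidableEq Q] [DecidableEq C]
    {p : ℕ} (P : Matrix (Fin p) Q ℝ) (W : Matrix (Fin p) C ℝ) (δ : ℝ) (q : Q)
    (S : Finset C) (z : (Q → ℝ) × (C → ℝ)) :
    P.mulVec (correlate δ q S z).1 + W.mulVec (correlate δ q S z).2 =
      (correlatedParents P W δ q S).mulVec z.1 + (correlatedChildren W δ S).mulVec z.2 := by
  ext i
  have h1 : ∑ c, W i c * (if c ∈ S then δ * z.1 q + √(1 - δ ^ 2) * z.2 c else z.2 c) =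
      δ * (∑ c ∈ S, W i c) * z.1 q +
        ∑ c, W i c * (if c ∈ S then √(1 - δ ^ 2) else 1) * z.2 c := by
    rw [Finset.mul_sum, Finset.sum_mul, ← Finset.univ_inter S, ← Finset.sum_ite_mem,
      ← Finset.sum_add_distrib]
    refine Finset.sum_congr rfl fun c _ => ?_
    simp only [Finset.univ_inter]
    split_ifs <;> ring
  simp only [Pi.add_apply, Matrix.mulVec, dotProduct, correlate, correlatedParents,
    correlatedChildren, Matrix.of_apply, h1, add_mul, Finset.sum_add_distrib, ite_mul, zero_mul,
    Finset.sum_ite_eq', Finset.mem_univ, if_true]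
  ring

theorem correlatedCov_posSemidef {Q C : Type*} [Fintype Q] [Fintype C] {p : ℕ}
    (P : Matrix (Fin p) Q ℝ) (W : Matrix (Fin p) C ℝ) {δ : ℝ} (hδ : δ ^ 2 ≤ 1) (q : Q)
    (S : Finset C) : (correlatedCov P W δ q S).PosSemidef := by
  classical
  rw [← correlatedCov_eq P W hδ]
  have h1 := Matrix.posSemidef_self_mul_conjTranspose (correlatedParents P W δ q S)
  have h2 := Matrix.posSemidef_self_mul_conjTranspose (correlatedChildren W δ S)
  rw [Matrix.conjTranspose_eq_transpose_of_trivial] at h1 h2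
  exact h1.add h2

/-- An observation as a function of the latent variables. -/
def designVec {Q C : Type*} [Fintype Q] [Fintype C] {p : ℕ} (P : Matrix (Fin p) Q ℝ)
    (W : Matrix (Fin p) C ℝ) (z : (Q → ℝ) × (C → ℝ)) : EuclideanSpace ℝ (Fin p) :=
  WithLp.toLp 2 (P.mulVec z.1 + W.mulVec z.2)

/-- The sample as a function of `n` independent copies of the latent variables. -/
def designMap {Q C : Type*} [Fintype Q] [Fintype C] {n p : ℕ} (P : Matrix (Fin p) Q ℝ)
    (W : Matrix (Fin p) C ℝ) (Z : Fin n → (Q → ℝ) × (C → ℝ)) : Fin n → EuclideanSpace ℝ (Fin p) :=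
  fun i => designVec P W (Z i)

@[fun_prop]
theorem measurable_designVec {Q C : Type*} [Fintype Q] [Fintype C] {p : ℕ}
    (P : Matrix (Fin p) Q ℝ) (W : Matrix (Fin p) C ℝ) : Measurable (designVec P W) := by
  refine Continuous.measurable ?_
  unfold designVec
  fun_prop

@[fun_prop]
theorem measurable_designMap {Q C : Type*} [Fintype Q] [Fintype C] {n p : ℕ}
    (P : Matrix (Fin p) Q ℝ) (W : Matrix (Fin p) C ℝ) :
    Measurable (designMap (n := n) P W) :=
  measurable_pi_lambda _ fun i => (measurable_designVec P W).comp (measurable_pi_apply i)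

/-! ### Samples of size `n`. -/

/-- The law of the `n` independent copies of the latent variables. -/
abbrev latentSample (n : ℕ) (Q C : Type*) [Fintype Q] [Fintype C] :
    Measure (Fin n → (Q → ℝ) × (C → ℝ)) :=
  Measure.pi fun _ => latentGaussian Q C

/-- The likelihood ratio of `n` independent correlated copies. -/
def sampleDensity {Q C : Type*} [Fintype C] [DecidableEq C] {n : ℕ} (δ : ℝ) (q : Q)
    (S : Finset C) (Z : Fin n → (Q → ℝ) × (C → ℝ)) : ENNReal :=
  ∏ i, correlateDensity δ q S (Z i)

@[fun_prop]
theorem measurable_sampleDensity {Q C : Type*} [Fintype C] [DecidableEq C] {n : ℕ} (δ : ℝ) (q : Q)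
    (S : Finset C) : Measurable (sampleDensity (n := n) δ q S) :=
  Finset.measurable_fun_prod _ fun i _ =>
    (measurable_correlateDensity δ q S).comp (measurable_pi_apply i)

theorem latentSample_withDensity {Q C : Type*} [Fintype Q] [Fintype C] [DecidableEq C] {n : ℕ}
    {δ : ℝ} (hδ : δ ^ 2 < 1) (q : Q) (S : Finset C) :
    (latentSample n Q C).withDensity (sampleDensity δ q S) =
      (latentSample n Q C).map (fun Z i => correlate δ q S (Z i)) := by
  have hprob : IsProbabilityMeasure ((latentGaussian Q C).map (correlate δ q S)) :=
    Measure.isProbabilityMeasure_map (by fun_prop)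
  have hprob' := hprob
  rw [map_correlate hδ] at hprob'
  rw [Measure.pi_map_pi (f := fun _ => correlate δ q S) fun _ => by fun_prop]
  simp_rw [map_correlate hδ]
  rw [pi_withDensity (fun _ : Fin n => latentGaussian Q C) (fun _ => correlateDensity δ q S)
    fun _ => by fun_prop]
  rfl

theorem map_designMap_latentSample {Q C : Type*} [Fintype Q] [Fintype C] {n p : ℕ}
    (P : Matrix (Fin p) Q ℝ) (W : Matrix (Fin p) C ℝ) :
    (latentSample n Q C).map (designMap P W) =
      gaussianSample n p (P * P.transpose + W * W.transpose) := by
  have hprob : IsProbabilityMeasure ((latentGaussian Q C).map (designVec P W)) :=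
    Measure.isProbabilityMeasure_map (by fun_prop)
  have h := Measure.pi_map_pi (μ := fun _ : Fin n => latentGaussian Q C)
    (f := fun _ => designVec P W) fun _ => by fun_prop
  have hlaw : (latentGaussian Q C).map (designVec P W) = _ := map_latentGaussian_mulVec P W
  simp_rw [hlaw] at h
  exact h

/-- The observation map is the same under null and alternative; only the latent law changes. This
replaces a density of the sample, which need not exist. -/
theorem gaussianSample_correlatedCov {Q C : Type*} [Fintype Q] [Fintype C] [DecidableEq C]
    {n p : ℕ} (P : Matrix (Fin p) Q ℝ) (W : Matrix (Fin p) C ℝ) {δ : ℝ} (hδ : δ ^ 2 < 1) (q : Q)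
    (S : Finset C) :
    gaussianSample n p (correlatedCov P W δ q S) =
      ((latentSample n Q C).withDensity (sampleDensity δ q S)).map (designMap P W) := by
  classical
  have hm : Measurable fun (Z : Fin n → (Q → ℝ) × (C → ℝ)) i => correlate δ q S (Z i) :=
    measurable_pi_lambda _ fun i => (measurable_correlate δ q S).comp (measurable_pi_apply i)
  rw [latentSample_withDensity hδ, Measure.map_map (by fun_prop) hm,
    ← correlatedCov_eq P W hδ.le, ← map_designMap_latentSample]
  congr 1
  funext Z i
  simp only [Function.comp, designMap, designVec, mulVec_correlate]

/-! ### Truncation on the parents and the truncated second moment. -/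

theorem lintegral_sq_gaussianReal :
    ∫⁻ x, ENNReal.ofReal (x ^ 2) ∂gaussianReal 0 1 = 1 := by
  have h := variance_fun_id_gaussianReal (μ := 0) (v := 1)
  rw [variance_eq_integral (by fun_prop)] at h
  simp only [integral_id_gaussianReal, sub_zero, NNReal.coe_one] at h
  rw [← ofReal_integral_eq_lintegral_ofReal _ (ae_of_all _ fun x => sq_nonneg x), h]
  · simp
  -- Without integrability the Bochner integral would take its default value `0`, but the variance
  -- is `1`.
  · by_contra hn
    rw [integral_undef hn] at h
    norm_num at h

/-- The event that the parent `q` has sample second moment at most `4`. -/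
def moderateParent (n : ℕ) {Q : Type*} (C : Type*) (q : Q) : Set (Fin n → (Q → ℝ) × (C → ℝ)) :=
  {Z | ∑ i, (Z i).1 q ^ 2 ≤ 4 * n}

theorem measurableSet_moderateParent (n : ℕ) {Q : Type*} (C : Type*) (q : Q) :
    MeasurableSet (moderateParent n C q) :=
  measurableSet_le (by fun_prop) (by fun_prop)

/-- Markov's inequality: the sum of squares has mean `n`. -/
theorem le_latentSample_moderateParent {n : ℕ} (hn : 0 < n) {Q : Type*} (C : Type*) [Fintype Q]
    [Fintype C] (q : Q) : 3 / 4 ≤ latentSample n Q C (moderateParent n C q) := by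
  have hn' : (0 : ℝ) < n := by exact_mod_cast hn
  have hmean : ∫⁻ Z : Fin n → (Q → ℝ) × (C → ℝ), ∑ i, ENNReal.ofReal ((Z i).1 q ^ 2)
      ∂latentSample n Q C = n := by
    rw [lintegral_finsetSum _ fun i _ => by fun_prop]
    have : ∀ i : Fin n, ∫⁻ Z : Fin n → (Q → ℝ) × (C → ℝ), ENNReal.ofReal ((Z i).1 q ^ 2)
        ∂latentSample n Q C = 1 := fun i => by
      have hp : MeasurePreserving (fun Z : Fin n → (Q → ℝ) × (C → ℝ) => (Z i).1 q)
          (latentSample n Q C) (gaussianReal 0 1) :=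
        (measurePreserving_eval (fun _ : Q => gaussianReal 0 1) q).comp
          (measurePreserving_fst.comp
            (measurePreserving_eval (fun _ : Fin n => latentGaussian Q C) i))
      rw [← lintegral_sq_gaussianReal]
      exact hp.lintegral_comp (f := fun x => ENNReal.ofReal (x ^ 2)) (by fun_prop)
    simp [this]
  have hmarkov := mul_meas_ge_le_lintegral (μ := latentSample n Q C)
    (f := fun Z : Fin n → (Q → ℝ) × (C → ℝ) => ∑ i, ENNReal.ofReal ((Z i).1 q ^ 2))
    (by fun_prop) (4 * n)
  rw [hmean] at hmarkov
  have hsub : (moderateParent n C q)ᶜ ⊆ {Z : Fin n → (Q → ℝ) × (C → ℝ) |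
      (4 * n : ENNReal) ≤ ∑ i, ENNReal.ofReal ((Z i).1 q ^ 2)} := by
    intro Z hZ
    simp only [moderateParent, Set.mem_compl_iff, Set.mem_ofPred_eq, not_le] at hZ ⊢
    rw [← ENNReal.ofReal_sum_of_nonneg fun i _ => sq_nonneg _]
    have : (4 * n : ENNReal) = ENNReal.ofReal (4 * n) := by
      rw [ENNReal.ofReal_mul (by norm_num)]; simp
    rw [this]
    exact ENNReal.ofReal_le_ofReal hZ.le
  have hc : latentSample n Q C (moderateParent n C q)ᶜ ≤ 1 / 4 := by
    have h1 := (mul_le_mul_right (measure_mono (μ := latentSample n Q C) hsub)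
      (4 * n : ENNReal)).trans hmarkov
    rw [mul_comm (4 : ENNReal), mul_assoc] at h1
    have h2 : (4 : ENNReal) * latentSample n Q C (moderateParent n C q)ᶜ ≤ 1 := by
      rw [← ENNReal.mul_le_mul_iff_right (a := (n : ENNReal)) (by simpa using hn.ne') (by simp),
        mul_one]
      exact h1
    rw [ENNReal.le_div_iff_mul_le (by simp) (by simp), mul_comm]
    exact h2
  have hsum := measure_add_measure_compl (μ := latentSample n Q C)
    (measurableSet_moderateParent n C q)
  rw [measure_univ] at hsum
  have h3 : (3 / 4 : ENNReal) + 1 / 4 = 1 := by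
    rw [ENNReal.div_add_div_same]; norm_num
    exact ENNReal.div_self (by simp) (by simp)
  refine ENNReal.le_of_add_le_add_right (a := 1 / 4) (by simp) ?_
  refine (h3.trans hsum.symm).le.trans ?_
  exact add_le_add_right hc _

/-- Correlating changes only the children, so the truncation event keeps its probability under the
alternative. -/
theorem lintegral_indicator_sampleDensity {n : ℕ} {Q C : Type*} [Fintype Q]
    [Fintype C] [DecidableEq C] {δ : ℝ} (hδ : δ ^ 2 < 1) (q : Q) (S : Finset C) :
    ∫⁻ Z, (moderateParent n C q).indicator (sampleDensity δ q S) Z ∂latentSample n Q C =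
      latentSample n Q C (moderateParent n C q) := by
  have hB := measurableSet_moderateParent n C q
  have hm : Measurable fun (Z : Fin n → (Q → ℝ) × (C → ℝ)) i => correlate δ q S (Z i) :=
    measurable_pi_lambda _ fun i => (measurable_correlate δ q S).comp (measurable_pi_apply i)
  rw [lintegral_indicator hB, ← withDensity_apply _ hB, latentSample_withDensity hδ,
    Measure.map_apply hm hB]
  rfl

/-- On the truncation event the product over the sample of the weights in
`lintegral_correlateDensity_mul_le` is at least `1`. Inserting the weights therefore only increases
the integral, which then factorizes over the observations. Only the first truncation is needed. -/
theorem lintegral_indicator_sampleDensity_mul_le {n : ℕ} {Q C : Type*} [Fintype Q]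
    [Fintype C] [DecidableEq C] {δ : ℝ} (hδ : δ ^ 2 ≤ 1 / 2) (q q' : Q)
    (S S' : Finset C) (h : (S ∩ S').Nonempty → q = q') :
    ∫⁻ Z, (moderateParent n C q).indicator (sampleDensity δ q S) Z *
        (moderateParent n C q').indicator (sampleDensity δ q' S') Z ∂latentSample n Q C ≤
      ENNReal.ofReal (Real.exp (5 * n * δ ^ 2 * (S ∩ S').card)) := by
  set m : ℝ := ((S ∩ S').card : ℝ)
  calc _ ≤ ∫⁻ Z, ∏ i : Fin n, (correlateDensity δ q S (Z i) * correlateDensity δ q' S' (Z i) *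
        ENNReal.ofReal (Real.exp (m * δ ^ 2 * (4 - (Z i).1 q ^ 2)))) ∂latentSample n Q C := by
        refine lintegral_mono fun Z => ?_
        by_cases hZ : Z ∈ moderateParent n C q
        · rw [Set.indicator_of_mem hZ, Finset.prod_mul_distrib, Finset.prod_mul_distrib]
          rw [← ENNReal.ofReal_prod_of_nonneg fun i _ => (Real.exp_pos _).le, ← Real.exp_sum,
            ← Finset.mul_sum, Finset.sum_sub_distrib]
          have h1 : (1 : ENNReal) ≤ ENNReal.ofReal
              (Real.exp (m * δ ^ 2 * (∑ _i : Fin n, 4 - ∑ i, (Z i).1 q ^ 2))) := by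
            rw [ENNReal.one_le_ofReal, Real.one_le_exp_iff]
            have hZ' : ∑ i, (Z i).1 q ^ 2 ≤ 4 * n := hZ
            refine mul_nonneg (by positivity) ?_
            simp only [Finset.sum_const, Finset.card_univ, Fintype.card_fin, nsmul_eq_mul]
            linarith
          refine le_trans ?_ (le_mul_of_one_le_right' h1)
          exact mul_le_mul_right (Set.indicator_le_self _ _ _) _
        · rw [Set.indicator_of_notMem hZ, zero_mul]
          exact zero_le
    _ = ∏ _i : Fin n, ∫⁻ z, correlateDensity δ q S z * correlateDensity δ q' S' z *
        ENNReal.ofReal (Real.exp (m * δ ^ 2 * (4 - z.1 q ^ 2))) ∂latentGaussian Q C :=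
        lintegral_pi_prod (fun _ : Fin n => latentGaussian Q C)
          (fun _ z => correlateDensity δ q S z * correlateDensity δ q' S' z *
            ENNReal.ofReal (Real.exp (m * δ ^ 2 * (4 - z.1 q ^ 2)))) (fun _ => by fun_prop)
    _ ≤ ∏ _i : Fin n, ENNReal.ofReal (Real.exp (5 * δ ^ 2 * m)) :=
        Finset.prod_le_prod' fun _ _ => lintegral_correlateDensity_mul_le hδ q q' S S' h
    _ = _ := by
        rw [Finset.prod_const, Finset.card_univ, Fintype.card_fin,
          ← ENNReal.ofReal_pow (Real.exp_pos _).le, ← Real.exp_nat_mul]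
        congr 2
        ring

/-! ### Le Cam's method with a mixture of alternatives. -/

theorem ENNReal.le_one_add_mul_self_div_four (f : ENNReal) : f ≤ 1 + f * f / 4 := by
  induction f with
  | top => simp [ENNReal.top_div]
  | coe x =>
    have h : x ≤ 1 + x * x / 4 := by
      rw [← NNReal.coe_le_coe]
      push_cast
      nlinarith [sq_nonneg ((x : ℝ) - 2)]
    have : ((1 + x * x / 4 : NNReal) : ENNReal) = 1 + (x : ENNReal) * x / 4 := by
      push_cast [ENNReal.coe_div (show (4 : NNReal) ≠ 0 by norm_num)]
      rfl
    rw [← this]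
    exact_mod_cast h

/-- Le Cam's method for a point null against a uniform mixture, in the form of a second moment
bound for the (truncated) likelihood ratio `f`. -/
theorem one_div_four_le_testing_error {Ω : Type*} [MeasurableSpace Ω] {ν : Measure Ω}
    {f : Ω → ENNReal} (hf : Measurable f) (h1 : 3 / 4 ≤ ∫⁻ ω, f ω ∂ν)
    (h2 : ∫⁻ ω, f ω * f ω ∂ν ≤ 2) {E : Set Ω} (hE : MeasurableSet E) :
    1 / 4 ≤ ∫⁻ ω, (E.indicator 1 ω + Eᶜ.indicator f ω) ∂ν := by
  have hm : Measurable fun ω => E.indicator 1 ω + Eᶜ.indicator f ω :=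
    (measurable_one.indicator hE).add (hf.indicator hE.compl)
  -- On `E` this is `(f - 2)² ≥ 0`; off `E` it is trivial. Integration gives an error of at least
  -- `3/4 - 2/4`.
  have hpt : ∀ ω, f ω ≤ (E.indicator 1 ω + Eᶜ.indicator f ω) + f ω * f ω / 4 := by
    intro ω
    by_cases hω : ω ∈ E
    · simpa [hω] using ENNReal.le_one_add_mul_self_div_four (f ω)
    · simp [hω]
  have h3 := h1.trans (lintegral_mono hpt)
  rw [lintegral_add_left hm] at h3
  have h4 : ∫⁻ ω, f ω * f ω / 4 ∂ν ≤ 2 / 4 := by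
    simp_rw [ENNReal.div_eq_inv_mul]
    rw [lintegral_const_mul (f := fun ω => f ω * f ω) _ (hf.mul hf)]
    exact mul_le_mul_right h2 _
  refine ENNReal.le_of_add_le_add_right (a := 2 / 4) (by simp [ENNReal.div_eq_top]) ?_
  refine le_trans (le_of_eq ?_) (h3.trans (add_le_add_right h4 _))
  rw [ENNReal.div_add_div_same]; norm_num

theorem ofReal_mul_testing_error_le {ℓ₀ ℓ₁ a Δ t : ℝ} (hΔ : 0 ≤ Δ) (h0 : ℓ₀ ≤ a)
    (h1 : a + Δ ≤ ℓ₁) (g : ENNReal) :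
    ENNReal.ofReal (Δ ^ 2 / 4) * (if a + Δ / 2 ≤ t then 1 else g) ≤
      ENNReal.ofReal ((t - ℓ₀) ^ 2) + ENNReal.ofReal ((t - ℓ₁) ^ 2) * g := by
  split_ifs with h
  · rw [mul_one]
    exact le_add_right (ENNReal.ofReal_le_ofReal (by nlinarith))
  · exact le_add_left (mul_le_mul_left (ENNReal.ofReal_le_ofReal (by nlinarith)) _)

/-- Minimax lower bound from a family of correlated designs: the null design has a functional at
most `a`, every alternative has a functional at least `a + Δ`, and the overlaps of the alternatives
have a bounded exponential moment. -/
theorem le_ellMinimaxRisk_of_correlated {A Q C : Type*} [Fintype A] [Nonempty A] [Fintype Q]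
    [Fintype C] [DecidableEq C] {n p : ℕ} (hn : 0 < n) {q r R δ : ℝ} (hδ : δ ^ 2 ≤ 1 / 2)
    (P : Matrix (Fin p) Q ℝ) (W : Matrix (Fin p) C ℝ) (par : A → Q) (S : A → Finset C)
    (hpar : ∀ a b, (S a ∩ S b).Nonempty → par a = par b)
    (hmom : ∑ a, ∑ b, Real.exp (5 * n * δ ^ 2 * (S a ∩ S b).card) ≤ 2 * Fintype.card A ^ 2)
    (hnull : P * P.transpose + W * W.transpose ∈ rowSparseClass p q R)
    (halt : ∀ a, correlatedCov P W δ (par a) (S a) ∈ rowSparseClass p q R)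
    {ℓ Δ : ℝ} (hΔ : 0 ≤ Δ) (hℓ₀ : ellFunctional r (P * P.transpose + W * W.transpose) ≤ ℓ)
    (hℓ₁ : ∀ a, ℓ + Δ ≤ ellFunctional r (correlatedCov P W δ (par a) (S a))) :
    ENNReal.ofReal (Δ ^ 2 / 32) ≤ ellMinimaxRisk n p q r R := by
  have hδ1 : δ ^ 2 < 1 := by linarith
  refine le_iInf₂ fun L hL => ?_
  set s := ⨆ S ∈ rowSparseClass p q R,
      ∫⁻ X, ENNReal.ofReal ((L X - ellFunctional r S) ^ 2) ∂(gaussianSample n p S) with hs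
  set ν := latentSample n Q C
  let T : (Fin n → (Q → ℝ) × (C → ℝ)) → ℝ := fun Z => L (designMap P W Z)
  have hT : Measurable T := hL.comp (by fun_prop)
  let F : A → (Fin n → (Q → ℝ) × (C → ℝ)) → ENNReal := fun a => sampleDensity δ (par a) (S a)
  let F' : A → (Fin n → (Q → ℝ) × (C → ℝ)) → ENNReal := fun a =>
    (moderateParent n C (par a)).indicator (F a)
  have hF : ∀ a, Measurable (F a) := fun a => by fun_prop
  have hF' : ∀ a, Measurable (F' a) := fun a =>
    (hF a).indicator (measurableSet_moderateParent n C (par a))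
  have hcard0 : (Fintype.card A : ENNReal) ≠ 0 := by simp
  have hcardt : (Fintype.card A : ENNReal) ≠ ⊤ := by simp
  have hnull' : ∫⁻ Z, ENNReal.ofReal ((T Z -
      ellFunctional r (P * P.transpose + W * W.transpose)) ^ 2) ∂ν ≤ s := by
    refine le_trans (le_of_eq ?_) (le_iSup₂_of_le _ hnull le_rfl)
    rw [← map_designMap_latentSample, lintegral_map (by fun_prop) (by fun_prop)]
  have halt' : ∀ a, ∫⁻ Z, ENNReal.ofReal ((T Z -
      ellFunctional r (correlatedCov P W δ (par a) (S a))) ^ 2) * F' a Z ∂ν ≤ s := by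
    intro a
    refine le_trans ?_ (le_iSup₂_of_le _ (halt a) le_rfl)
    rw [gaussianSample_correlatedCov P W hδ1, lintegral_map (by fun_prop) (by fun_prop),
      lintegral_withDensity_eq_lintegral_mul _ (by fun_prop) (by fun_prop)]
    refine lintegral_mono fun Z => ?_
    rw [Pi.mul_apply, mul_comm]
    -- Truncation only lowers the risk under the alternative, so the full risk still dominates.
    exact mul_le_mul_left (Set.indicator_le_self _ _ _) _
  let f : (Fin n → (Q → ℝ) × (C → ℝ)) → ENNReal := fun Z =>
    (Fintype.card A : ENNReal)⁻¹ * ∑ a, F' a Z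
  have hf : Measurable f := (Finset.measurable_fun_sum _ fun a _ => hF' a).const_mul _
  have hf1 : 3 / 4 ≤ ∫⁻ Z, f Z ∂ν := by
    rw [lintegral_const_mul _ (Finset.measurable_fun_sum _ fun a _ => hF' a),
      lintegral_finsetSum _ fun a _ => hF' a]
    have : ∀ a, 3 / 4 ≤ ∫⁻ Z, F' a Z ∂ν := fun a =>
      (le_latentSample_moderateParent hn C (par a)).trans_eq
        (lintegral_indicator_sampleDensity hδ1 (par a) (S a)).symm
    refine le_trans (le_of_eq ?_) (mul_le_mul_right (Finset.sum_le_sum fun a _ => this a) _)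
    rw [Finset.sum_const, Finset.card_univ, nsmul_eq_mul, ← mul_assoc,
      ENNReal.inv_mul_cancel hcard0 hcardt, one_mul]
  have hf2 : ∫⁻ Z, f Z * f Z ∂ν ≤ 2 := by
    have : ∀ Z, f Z * f Z = ((Fintype.card A : ENNReal)⁻¹ * (Fintype.card A : ENNReal)⁻¹) *
        ∑ a, ∑ b, F' a Z * F' b Z := fun Z => by
      rw [← Finset.sum_mul_sum]; ring
    simp_rw [this]
    rw [lintegral_const_mul _ (by fun_prop), lintegral_finsetSum _ (fun a _ => by fun_prop)]
    have h2 : ∀ a, ∫⁻ Z, ∑ b, F' a Z * F' b Z ∂ν ≤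
        ∑ b, ENNReal.ofReal (Real.exp (5 * n * δ ^ 2 * (S a ∩ S b).card)) := fun a => by
      rw [lintegral_finsetSum _ (fun b _ => by fun_prop)]
      exact Finset.sum_le_sum fun b _ =>
        lintegral_indicator_sampleDensity_mul_le hδ _ _ _ _ (hpar a b)
    refine (mul_le_mul_right (Finset.sum_le_sum fun a _ => h2 a) _).trans ?_
    have h3 : ∑ a, ∑ b, ENNReal.ofReal (Real.exp (5 * n * δ ^ 2 * (S a ∩ S b).card)) ≤
        2 * (Fintype.card A : ENNReal) ^ 2 := by
      simp_rw [← ENNReal.ofReal_sum_of_nonneg fun _ _ => (Real.exp_pos _).le]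
      rw [← ENNReal.ofReal_sum_of_nonneg fun _ _ =>
        Finset.sum_nonneg fun _ _ => (Real.exp_pos _).le]
      refine (ENNReal.ofReal_le_ofReal hmom).trans_eq ?_
      rw [ENNReal.ofReal_mul (by norm_num), ENNReal.ofReal_pow (by positivity)]
      simp
    refine (mul_le_mul_right h3 _).trans_eq ?_
    calc _ = 2 * (((Fintype.card A : ENNReal)⁻¹ * Fintype.card A) *
        ((Fintype.card A : ENNReal)⁻¹ * Fintype.card A)) := by ring
      _ = 2 := by rw [ENNReal.inv_mul_cancel hcard0 hcardt]; simp
  -- The test thresholds the estimator midway. Each error costs `Δ² / 4`, the total error is at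
  -- least `1/4`, and the two risks sum to at most `2 s`, whence `Δ² / 32`.
  let E : Set (Fin n → (Q → ℝ) × (C → ℝ)) := {Z | ℓ + Δ / 2 ≤ T Z}
  have hE : MeasurableSet E := measurableSet_le measurable_const hT
  have htest := one_div_four_le_testing_error hf hf1 hf2 hE
  have hpt : ∀ Z, ENNReal.ofReal (Δ ^ 2 / 4) * (E.indicator 1 Z + Eᶜ.indicator f Z) ≤
      ENNReal.ofReal ((T Z - ellFunctional r (P * P.transpose + W * W.transpose)) ^ 2) +
      (Fintype.card A : ENNReal)⁻¹ * ∑ a, ENNReal.ofReal ((T Z -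
        ellFunctional r (correlatedCov P W δ (par a) (S a))) ^ 2) * F' a Z := by
    intro Z
    have hsum := Finset.sum_le_sum fun a (_ : a ∈ Finset.univ) =>
      ofReal_mul_testing_error_le (t := T Z) hΔ hℓ₀ (hℓ₁ a) (F' a Z)
    have hsum := mul_le_mul_right hsum (Fintype.card A : ENNReal)⁻¹
    rw [Finset.sum_add_distrib, mul_add, Finset.sum_const, Finset.card_univ, nsmul_eq_mul,
      ← mul_assoc, ENNReal.inv_mul_cancel hcard0 hcardt, one_mul] at hsum
    refine le_trans (le_of_eq ?_) hsum
    rw [← Finset.mul_sum, mul_left_comm]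
    congr 1
    by_cases hZ : ℓ + Δ / 2 ≤ T Z
    · have hZ' : Z ∈ E := hZ
      simp [hZ, hZ', ENNReal.inv_mul_cancel hcard0 hcardt]
    · have hZ' : Z ∉ E := hZ
      simp [hZ, hZ', f]
  have hint := lintegral_mono hpt (μ := ν)
  have hmE : Measurable fun Z => E.indicator 1 Z + Eᶜ.indicator f Z :=
    (measurable_one.indicator hE).add (hf.indicator hE.compl)
  have hm0 : Measurable fun Z => ENNReal.ofReal ((T Z -
      ellFunctional r (P * P.transpose + W * W.transpose)) ^ 2) := by fun_prop
  rw [lintegral_const_mul _ hmE, lintegral_add_left hm0,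
    lintegral_const_mul _ (by fun_prop), lintegral_finsetSum _ fun a _ => by fun_prop] at hint
  have hright := add_le_add hnull' (mul_le_mul_right
    (Finset.sum_le_sum fun a (_ : a ∈ Finset.univ) => halt' a) (Fintype.card A : ENNReal)⁻¹)
  rw [Finset.sum_const, Finset.card_univ, nsmul_eq_mul, ← mul_assoc,
    ENNReal.inv_mul_cancel hcard0 hcardt, one_mul, ← two_mul] at hright
  have hfin := ((mul_le_mul_right htest _).trans hint).trans hright
  have h8 : ENNReal.ofReal (Δ ^ 2 / 4) * (1 / 4) = 2 * ENNReal.ofReal (Δ ^ 2 / 32) := by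
    have h4 : (1 / 4 : ENNReal) = ENNReal.ofReal (1 / 4) := by
      rw [ENNReal.ofReal_div_of_pos (by norm_num)]; simp
    have h2 : (2 : ENNReal) = ENNReal.ofReal 2 := by simp
    rw [h4, h2, ← ENNReal.ofReal_mul (by positivity), ← ENNReal.ofReal_mul (by positivity)]
    congr 1
    ring
  rw [h8] at hfin
  exact (ENNReal.mul_le_mul_iff_right (by simp) (by simp)).1 hfin

/-! ### Row sums and the design of paired groups. -/

theorem absPow_one (e : ℝ) : absPow e 1 = 1 := by simp [absPow]

theorem absPow_zero (e : ℝ) : absPow e 0 = 0 := by simp [absPow]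

theorem absPow_of_pos {e x : ℝ} (hx : 0 < x) : absPow e x = x ^ e := by
  simp [absPow, hx.ne', abs_of_pos hx]

theorem ellFunctional_le {p : ℕ} (hp : 0 < p) {r a : ℝ} {S : Matrix (Fin p) (Fin p) ℝ}
    (h : ∀ i, ∑ j, absPow r (S i j) ≤ a) : ellFunctional r S ≤ a := by
  have : Nonempty (Fin p) := ⟨⟨0, hp⟩⟩
  exact ciSup_le h

theorem le_ellFunctional {p : ℕ} {r a : ℝ} {S : Matrix (Fin p) (Fin p) ℝ} (i : Fin p)
    (h : a ≤ ∑ j, absPow r (S i j)) : a ≤ ellFunctional r S :=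
  h.trans (le_ciSup (f := fun i => ∑ j, absPow r (S i j)) (Set.finite_range _).bddAbove i)

theorem card_filter_div_eq_le {m : ℕ} (hm : 0 < m) (p s : ℕ) :
    (Finset.univ.filter fun j : Fin p => (j : ℕ) / m = s).card ≤ m := by
  calc _ ≤ (Finset.range m).card := by
        refine Finset.card_le_card_of_injOn (fun j : Fin p => (j : ℕ) % m)
          (fun j _ => by simpa using Nat.mod_lt _ hm) ?_
        intro i hi j hj hij
        simp only [Finset.coe_filter, Finset.mem_univ, true_and, Set.mem_ofPred_eq] at hi hj hij
        ext
        rw [← Nat.div_add_mod (i : ℕ) m, ← Nat.div_add_mod (j : ℕ) m, hi, hj, hij]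
    _ = m := Finset.card_range m

theorem le_card_filter_div_eq {m : ℕ} (hm : 0 < m) {p s : ℕ} (h : (s + 1) * m ≤ p) :
    m ≤ (Finset.univ.filter fun j : Fin p => (j : ℕ) / m = s).card := by
  have hlt : ∀ x : Fin m, s * m + x < p := fun x => by
    have := x.2
    rw [add_mul] at h
    omega
  calc m = (Finset.univ : Finset (Fin m)).card := by simp
    _ ≤ _ := by
        refine Finset.card_le_card_of_injOn (fun x : Fin m => (⟨s * m + x, hlt x⟩ : Fin p))
          (fun x _ => ?_) (fun x _ y _ hxy => ?_)
        · simp only [Finset.coe_filter, Finset.mem_univ, true_and, Set.mem_ofPred_eq]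
          rw [mul_comm, Nat.mul_add_div hm, Nat.div_eq_of_lt x.2, add_zero]
        · ext
          simpa using hxy

/-- Blocks of `2 m` consecutive variables, each consisting of two groups of `m` copies of one
variable. The two groups of block `s` have correlation `t s`; distinct blocks are uncorrelated. -/
def pairBlockCov (p m : ℕ) (t : ℕ → ℝ) : Matrix (Fin p) (Fin p) ℝ :=
  Matrix.of fun i j => if (i : ℕ) / m = j / m then 1 else
    if (i : ℕ) / m / 2 = j / m / 2 then t (i / m / 2) else 0

theorem sum_absPow_pairBlockCov {p m : ℕ} {t : ℕ → ℝ} (ht : ∀ s, 0 < t s) (e : ℝ)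
    (i : Fin p) : ∃ s : ℕ, (i : ℕ) / m / 2 = s / 2 ∧
    ∑ j, absPow e (pairBlockCov p m t i j) =
      (Finset.univ.filter fun j : Fin p => (j : ℕ) / m = i / m).card +
      (Finset.univ.filter fun j : Fin p => (j : ℕ) / m = s).card * t (i / m / 2) ^ e := by
  -- `s` is the other group of the block. Near index `p` it may be incomplete or empty, so only
  -- complete blocks give lower bounds.
  obtain ⟨s, hs1, hs2⟩ : ∃ s, (i : ℕ) / m / 2 = s / 2 ∧ (i : ℕ) / m ≠ s := by
    rcases Nat.even_or_odd ((i : ℕ) / m) with h | h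
    · exact ⟨i / m + 1, by grind, by omega⟩
    · exact ⟨i / m - 1, by grind, by grind⟩
  refine ⟨s, hs1, ?_⟩
  rw [Finset.card_filter, Finset.card_filter]
  push_cast
  rw [Finset.sum_mul, ← Finset.sum_add_distrib]
  refine Finset.sum_congr rfl fun j _ => ?_
  simp only [pairBlockCov, Matrix.of_apply]
  by_cases h1 : (i : ℕ) / m = j / m
  · rw [if_pos h1, if_pos h1.symm, if_neg (by omega), absPow_one]; simp
  · rw [if_neg h1, if_neg (Ne.symm h1)]
    by_cases h2 : (i : ℕ) / m / 2 = j / m / 2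
    · rw [if_pos h2, if_pos (by omega), absPow_of_pos (ht _)]; simp
    · rw [if_neg h2, if_neg (by omega), absPow_zero]; simp

theorem sum_absPow_pairBlockCov_le {p m : ℕ} (hm : 0 < m) {t : ℕ → ℝ} (ht : ∀ s, 0 < t s) (e : ℝ)
    (i : Fin p) : ∑ j, absPow e (pairBlockCov p m t i j) ≤ m * (1 + t (i / m / 2) ^ e) := by
  obtain ⟨s, -, hs⟩ := sum_absPow_pairBlockCov (m := m) ht e i
  have h1 : ((Finset.univ.filter fun j : Fin p => (j : ℕ) / m = i / m).card : ℝ) ≤ m := by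
    exact_mod_cast card_filter_div_eq_le hm p _
  have h2 : ((Finset.univ.filter fun j : Fin p => (j : ℕ) / m = s).card : ℝ) ≤ m := by
    exact_mod_cast card_filter_div_eq_le hm p _
  rw [hs, mul_add, mul_one]
  have := Real.rpow_pos_of_pos (ht (i / m / 2)) e
  gcongr

theorem le_ellFunctional_pairBlockCov {p m : ℕ} (hm : 0 < m) {t : ℕ → ℝ} (ht : ∀ s, 0 < t s)
    (r : ℝ) {a : ℕ} (ha : (2 * a + 2) * m ≤ p) :
    m * (1 + t a ^ r) ≤ ellFunctional r (pairBlockCov p m t) := by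
  have hlt : 2 * a * m < p := by nlinarith
  refine le_ellFunctional ⟨2 * a * m, hlt⟩ ?_
  obtain ⟨s, hs1, hs⟩ := sum_absPow_pairBlockCov (m := m) ht r (⟨2 * a * m, hlt⟩ : Fin p)
  have hd : 2 * a * m / m = 2 * a := Nat.mul_div_cancel _ hm
  have hd2 : 2 * a / 2 = a := by omega
  simp only [hd, hd2] at hs hs1
  rw [hs, mul_add, mul_one]
  have h1 := le_card_filter_div_eq hm (p := p) (s := 2 * a) (by nlinarith)
  have h2 := le_card_filter_div_eq hm (p := p) (s := s) (by
    have : s + 1 ≤ 2 * a + 2 := by omega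
    nlinarith)
  have := Real.rpow_pos_of_pos (ht a) r
  gcongr

/-- The block containing a variable. -/
def pairBlock {p : ℕ} (m : ℕ) (i : Fin p) : Fin p :=
  ⟨i / m / 2, ((Nat.div_le_self _ _).trans (Nat.div_le_self _ _)).trans_lt i.2⟩

/-- Loadings of the factor shared by a block and of the factor of its first group. -/
def pairParents (p m : ℕ) (b : ℝ) : Matrix (Fin p) (Fin p ⊕ Fin p) ℝ :=
  Matrix.of fun i => Sum.elim (fun t => if t = pairBlock m i then √b else 0)
    (fun t => if t = pairBlock m i then if (i : ℕ) / m % 2 = 0 then √(1 - b) else 0 else 0)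

/-- Loadings of the factor of the second group of a block. -/
def pairChildren (p m : ℕ) (b : ℝ) : Matrix (Fin p) (Fin p) ℝ :=
  Matrix.of fun i t => if t = pairBlock m i then if (i : ℕ) / m % 2 = 0 then 0 else √(1 - b) else 0

/-- A group variable is `√b` times the block factor plus `√(1 - b)` times its group factor.
Correlating the two group factors of block `a` adds `(1 - b) δ` to the correlation between its
groups. -/
theorem correlatedCov_pair {p m : ℕ} {b : ℝ} (hb0 : 0 ≤ b) (hb1 : b ≤ 1) (δ : ℝ) (a : Fin p) :
    correlatedCov (pairParents p m b) (pairChildren p m b) δ (.inr a) {a} =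
      pairBlockCov p m fun s => if s = a then b + (1 - b) * δ else b := by
  ext i j
  have h1 := Real.mul_self_sqrt hb0
  have h2 := Real.mul_self_sqrt (sub_nonneg.2 hb1)
  have hblk : pairBlock m i = pairBlock m j ↔ (i : ℕ) / m / 2 = j / m / 2 := by
    simp [pairBlock, Fin.ext_iff]
  have ha : a = pairBlock m i ↔ (i : ℕ) / m / 2 = a := by
    simp [pairBlock, Fin.ext_iff, eq_comm]
  rw [show pairBlockCov p m (fun s => if s = a then b + (1 - b) * δ else b) i j =
    if (i : ℕ) / m = j / m then 1 else if pairBlock m i = pairBlock m j then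
      if a = pairBlock m i then b + (1 - b) * δ else b else 0 by
    simp only [pairBlockCov, Matrix.of_apply, hblk, ha]]
  have hpar : (i : ℕ) / m = j / m ↔
      pairBlock m i = pairBlock m j ∧ (i : ℕ) / m % 2 = j / m % 2 := by
    rw [hblk]; omega
  simp only [correlatedCov, Matrix.of_apply, pairParents, pairChildren, hpar,
    Fintype.sum_sum_type, Sum.elim_inl, Sum.elim_inr, ite_mul, zero_mul,
    Finset.sum_ite_eq', Finset.mem_univ, if_true]
  generalize pairBlock m i = x
  generalize pairBlock m j = y
  generalize √b = u at *
  generalize √(1 - b) = v at *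
  rcases Nat.mod_two_eq_zero_or_one ((i : ℕ) / m) with hi | hi <;>
  rcases Nat.mod_two_eq_zero_or_one ((j : ℕ) / m) with hj | hj <;>
  by_cases hxy : x = y <;> by_cases hax : a = x <;>
  (try subst hxy) <;> (try subst hax) <;> simp [*, sq] <;> grind

theorem correlatedCov_zero {Q C : Type*} [Fintype Q] [Fintype C] {p : ℕ} (P : Matrix (Fin p) Q ℝ)
    (W : Matrix (Fin p) C ℝ) (q : Q) (S : Finset C) :
    correlatedCov P W 0 q S = P * P.transpose + W * W.transpose := by
  ext i j
  simp [correlatedCov, Matrix.mul_apply]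

theorem pairBlockCov_mem_rowSparseClass {p m : ℕ} (hm : 0 < m) {q R b δ : ℝ} (hq : 0 ≤ q)
    (hb0 : 0 < b) (hb1 : b ≤ 1) (hδ0 : 0 ≤ δ) (hδ1 : δ ^ 2 ≤ 1) (a : Fin p)
    (hR : m * (1 + (b + (1 - b) * δ) ^ q) ≤ R) :
    correlatedCov (pairParents p m b) (pairChildren p m b) δ (.inr a) {a} ∈
      rowSparseClass p q R := by
  have hbδ : 0 ≤ (1 - b) * δ := mul_nonneg (by linarith) hδ0
  refine ⟨correlatedCov_posSemidef _ _ hδ1 _ _, fun i => ?_, fun i => ?_⟩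
  · rw [correlatedCov_pair hb0.le hb1]
    refine (sum_absPow_pairBlockCov_le hm (fun s => by split_ifs <;> linarith) q i).trans
      (le_trans ?_ hR)
    gcongr
    split_ifs <;> linarith
  · rw [correlatedCov_pair hb0.le hb1]
    simp [pairBlockCov]

/-- Lower bound from perturbing the correlation of one out of `p / (2 m)` pairs of groups. -/
theorem le_ellMinimaxRisk_of_pairs {n p m : ℕ} (hn : 0 < n) (hm : 0 < m) {q r R b δ : ℝ}
    (hq : 0 ≤ q) (hr : 0 ≤ r) (hb0 : 0 < b) (hb1 : b ≤ 1) (hδ0 : 0 ≤ δ) (hδ : δ ^ 2 ≤ 1 / 2)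
    (hR : m * (1 + (b + (1 - b) * δ) ^ q) ≤ R) (hM : 0 < p / (2 * m))
    (hexp : Real.exp (5 * n * δ ^ 2) ≤ (p / (2 * m) : ℕ)) :
    ENNReal.ofReal ((m * ((b + (1 - b) * δ) ^ r - b ^ r)) ^ 2 / 32) ≤ ellMinimaxRisk n p q r R := by
  set M := p / (2 * m) with hMdef
  have hbδ : 0 ≤ (1 - b) * δ := mul_nonneg (by linarith) hδ0
  have hMp : M * (2 * m) ≤ p := Nat.div_mul_le_self _ _
  have hblock : ∀ a : Fin M, (2 * (a : ℕ) + 2) * m ≤ p := fun a => by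
    have h1 : (a : ℕ) + 1 ≤ M := a.2
    calc (2 * (a : ℕ) + 2) * m = ((a : ℕ) + 1) * (2 * m) := by ring
      _ ≤ M * (2 * m) := Nat.mul_le_mul_right _ h1
      _ ≤ p := hMp
  have hMp' : M ≤ p := Nat.div_le_self _ _
  have hp : 0 < p := hM.trans_le hMp'
  have : Nonempty (Fin M) := ⟨⟨0, hM⟩⟩
  let ι : Fin M → Fin p := Fin.castLE hMp'
  have hι : Function.Injective ι := Fin.castLE_injective hMp'
  have hnull : pairParents p m b * (pairParents p m b).transpose +
      pairChildren p m b * (pairChildren p m b).transpose = correlatedCov (pairParents p m b)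
        (pairChildren p m b) 0 (.inr ⟨0, hp⟩) {⟨0, hp⟩} := (correlatedCov_zero _ _ _ _).symm
  have hinter : ∀ a c : Fin M, (({ι a} : Finset (Fin p)) ∩ {ι c}).card = if a = c then 1 else 0 := by
    intro a c
    by_cases h : a = c
    · simp [h]
    · rw [if_neg h, Finset.singleton_inter_of_notMem (by simpa using mt (@hι a c) h)]; rfl
  refine le_ellMinimaxRisk_of_correlated (A := Fin M) hn hδ (pairParents p m b)
    (pairChildren p m b) (fun a => .inr (ι a)) (fun a => {ι a}) ?_ ?_ ?_ ?_ (ℓ := m * (1 + b ^ r))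
    (mul_nonneg (Nat.cast_nonneg _) ?_) ?_ ?_
  · intro a c h
    rw [← Finset.card_pos, hinter] at h
    split_ifs at h with hac
    · rw [hac]
    · exact absurd h (lt_irrefl 0)
  -- Only the `M` diagonal pairs overlap, and each contributes at most `1 + M`, so the double sum is
  -- at most `2 M²`.
  · have hle : ∀ a c : Fin M, Real.exp (5 * n * δ ^ 2 * (({ι a} : Finset (Fin p)) ∩ {ι c}).card) ≤
        1 + if a = c then (M : ℝ) else 0 := fun a c => by
      rw [hinter]
      split_ifs
      · rw [Nat.cast_one, mul_one]; linarith
      · simp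
    refine (Finset.sum_le_sum fun a _ => Finset.sum_le_sum fun c _ => hle a c).trans_eq ?_
    simp only [Finset.sum_add_distrib, Finset.sum_const, Finset.card_univ, Fintype.card_fin,
      nsmul_eq_mul, Finset.sum_ite_eq, Finset.mem_univ, if_true]
    ring
  · rw [hnull]
    refine pairBlockCov_mem_rowSparseClass hm hq hb0 hb1 le_rfl (by norm_num) _ (le_trans ?_ hR)
    gcongr
  · exact fun a => pairBlockCov_mem_rowSparseClass hm hq hb0 hb1 hδ0 (by linarith) _ hR
  · rw [sub_nonneg]
    exact Real.rpow_le_rpow hb0.le (by linarith) hr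
  · rw [hnull, correlatedCov_pair hb0.le hb1]
    refine ellFunctional_le hp fun i => (sum_absPow_pairBlockCov_le hm
      (fun s => by split_ifs <;> linarith) r i).trans_eq ?_
    simp
  · intro a
    rw [correlatedCov_pair hb0.le hb1]
    refine le_trans (le_of_eq ?_) (le_ellFunctional_pairBlockCov hm
      (fun s => by split_ifs <;> linarith) r (hblock a))
    simp only [ι, Fin.val_castLE, if_true]
    ring

/-! ### The star design. -/

/-- The covariance of a common factor (variable `i₀`) whose correlation with the variables in `S`
is `δ`, and which makes them correlated among themselves. -/
def starCov {p : ℕ} (i₀ : Fin p) (δ : ℝ) (S : Finset (Fin p)) : Matrix (Fin p) (Fin p) ℝ :=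
  Matrix.of fun i j => if i = j then 1 else if i = i₀ then (if j ∈ S then δ else 0) else
    if j = i₀ then (if i ∈ S then δ else 0) else if i ∈ S ∧ j ∈ S then δ ^ 2 else 0

/-- Loadings of the common factor. -/
def starParents {p : ℕ} (i₀ : Fin p) : Matrix (Fin p) Unit ℝ :=
  Matrix.of fun i _ => if i = i₀ then 1 else 0

/-- Loadings of the idiosyncratic factors. -/
def starChildren {p : ℕ} (i₀ : Fin p) : Matrix (Fin p) (Fin p) ℝ :=
  Matrix.of fun i c => if c = i then (if i = i₀ then 0 else 1) else 0

theorem correlatedCov_star {p : ℕ} {i₀ : Fin p} (δ : ℝ) {S : Finset (Fin p)} (hS : i₀ ∉ S) :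
    correlatedCov (starParents i₀) (starChildren i₀) δ () S = starCov i₀ δ S := by
  ext i j
  simp only [correlatedCov, starParents, starChildren, starCov, Matrix.of_apply,
    Finset.univ_unique, Finset.sum_singleton, ite_mul, zero_mul, Finset.sum_ite_eq',
    Finset.mem_univ, if_true]
  by_cases hij : i = j
  · subst hij
    by_cases hi : i = i₀
    · subst hi; simp [hS]
    · by_cases hiS : i ∈ S <;> simp [hi, hiS]
  · have hji : ¬ j = i := Ne.symm hij
    by_cases hi : i = i₀
    · subst hi
      by_cases hjS : j ∈ S <;> simp [hij, hji, hjS, hS]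
    · by_cases hj : j = i₀
      · subst hj
        by_cases hiS : i ∈ S <;> simp [hij, hiS, hS]
      · by_cases hiS : i ∈ S <;> by_cases hjS : j ∈ S <;> simp [hij, hi, hj, hiS, hjS]

/-- The row of `i₀` is the largest: a row in `S` has one entry `δ` and `|S| - 1` entries `δ²`, and
`(δ²)^e ≤ δ^e` since `δ ≤ 1`. -/
theorem sum_absPow_starCov_le {p : ℕ} {i₀ : Fin p} {δ e : ℝ} {S : Finset (Fin p)}
    (hS : i₀ ∉ S) (hδ0 : 0 < δ) (hδ1 : δ ≤ 1) (he : 0 ≤ e) (i : Fin p) :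
    ∑ j, absPow e (starCov i₀ δ S i j) ≤ 1 + S.card * δ ^ e := by
  obtain ⟨T, hT, hle⟩ : ∃ T : Finset (Fin p), T.card ≤ S.card ∧ ∀ j,
      absPow e (starCov i₀ δ S i j) ≤ (if j = i then 1 else 0) + if j ∈ T then δ ^ e else 0 := by
    have hpos := Real.rpow_pos_of_pos hδ0 e
    have hsq : absPow e (δ ^ 2) ≤ δ ^ e := by
      rw [absPow_of_pos (by positivity)]
      exact Real.rpow_le_rpow (by positivity) (by nlinarith) he
    by_cases hi : i = i₀
    · subst hi
      refine ⟨S, le_rfl, fun j => ?_⟩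
      by_cases hj : j = i
      · subst hj; simp [starCov, hS, absPow_one]
      · have hj' : ¬ i = j := Ne.symm hj
        by_cases hjS : j ∈ S <;> simp [starCov, hj, hj', hjS, absPow_zero, absPow_of_pos hδ0]
    · by_cases hiS : i ∈ S
      · refine ⟨insert i₀ (S.erase i), ?_, fun j => ?_⟩
        · refine (Finset.card_insert_le _ _).trans ?_
          rw [Finset.card_erase_add_one hiS]
        · by_cases hij : j = i
          · subst hij
            simp only [starCov, Matrix.of_apply, if_true, absPow_one]
            split_ifs <;> linarith
          · have hij' : ¬ i = j := Ne.symm hij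
            by_cases hj : j = i₀
            · subst hj
              simp [starCov, hi, hij, hiS, absPow_of_pos hδ0]
            · by_cases hjS : j ∈ S <;> simp [starCov, hi, hij, hij', hj, hiS, hjS, absPow_zero, hsq]
      · refine ⟨∅, by simp, fun j => ?_⟩
        by_cases hij : j = i
        · subst hij; simp [starCov, absPow_one]
        · have hij' : ¬ i = j := Ne.symm hij
          simp [starCov, hi, hij, hij', hiS, absPow_zero]
  refine (Finset.sum_le_sum fun j _ => hle j).trans ?_
  rw [Finset.sum_add_distrib, Finset.sum_ite_eq', if_pos (Finset.mem_univ _), Finset.sum_ite_mem,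
    Finset.univ_inter, Finset.sum_const, nsmul_eq_mul]
  have : (T.card : ℝ) ≤ S.card := by exact_mod_cast hT
  gcongr

theorem le_ellFunctional_starCov {p : ℕ} {i₀ : Fin p} {δ r : ℝ} {S : Finset (Fin p)}
    (hS : i₀ ∉ S) (hδ0 : 0 < δ) : 1 + S.card * δ ^ r ≤ ellFunctional r (starCov i₀ δ S) := by
  refine le_ellFunctional i₀ (le_of_eq ?_)
  have : ∀ j, absPow r (starCov i₀ δ S i₀ j) =
      (if j = i₀ then 1 else 0) + if j ∈ S then δ ^ r else 0 := fun j => by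
    by_cases hj : j = i₀
    · subst hj; simp [starCov, hS, absPow_one]
    · have hj' : ¬ i₀ = j := Ne.symm hj
      by_cases hjS : j ∈ S <;> simp [starCov, hj, hj', hjS, absPow_zero, absPow_of_pos hδ0]
  simp_rw [this]
  rw [Finset.sum_add_distrib, Finset.sum_ite_eq', if_pos (Finset.mem_univ _), Finset.sum_ite_mem,
    Finset.univ_inter, Finset.sum_const, nsmul_eq_mul]

theorem starCov_mem_rowSparseClass {p : ℕ} {i₀ : Fin p} {δ q R : ℝ} {S : Finset (Fin p)}
    (hS : i₀ ∉ S) (hδ0 : 0 < δ) (hδ1 : δ ≤ 1) (hq : 0 ≤ q) (hR : 1 + S.card * δ ^ q ≤ R) :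
    starCov i₀ δ S ∈ rowSparseClass p q R := by
  refine ⟨?_, fun i => (sum_absPow_starCov_le hS hδ0 hδ1 hq i).trans hR, fun i => by simp [starCov]⟩
  rw [← correlatedCov_star δ hS]
  exact correlatedCov_posSemidef _ _ (by nlinarith) _ _

/-- With no children the correlation is immaterial; the value `1` meets the condition `0 < δ ≤ 1` of
`starCov_mem_rowSparseClass`. -/
theorem star_null {p : ℕ} (i₀ : Fin p) :
    starParents i₀ * (starParents i₀).transpose + starChildren i₀ * (starChildren i₀).transpose =
      starCov i₀ 1 ∅ := by
  rw [← correlatedCov_star 1 (Finset.notMem_empty i₀)]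
  ext i j
  simp [correlatedCov, Matrix.mul_apply]

/-- The overlap of two independent uniform selections of one element from each of `k` groups of
size `N`. -/
theorem sum_exp_card_agree (k N : ℕ) (c : ℝ) :
    ∑ a : Fin k → Fin N, ∑ b : Fin k → Fin N,
      Real.exp (c * (Finset.univ.filter fun g => a g = b g).card) =
        (N : ℝ) ^ k * (N - 1 + Real.exp c) ^ k := by
  have h1 : ∀ a b : Fin k → Fin N,
      Real.exp (c * (Finset.univ.filter fun g => a g = b g).card) =
        ∏ g, if a g = b g then Real.exp c else 1 := fun a b => by
    rw [Finset.prod_ite, Finset.prod_const, Finset.prod_const_one, mul_one, ← Real.exp_nat_mul,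
      mul_comm]
  have h2 : ∀ j : Fin N, ∑ j', (if j = j' then Real.exp c else 1) = N - 1 + Real.exp c := by
    intro j
    have : ∀ j' : Fin N, (if j = j' then Real.exp c else 1) =
        1 + if j = j' then Real.exp c - 1 else 0 := fun j' => by split_ifs <;> ring
    simp_rw [this]
    rw [Finset.sum_add_distrib, Finset.sum_ite_eq, if_pos (Finset.mem_univ _)]
    simp
    ring
  have h3 : ∀ a : Fin k → Fin N, ∑ b : Fin k → Fin N,
      ∏ g, (if a g = b g then Real.exp c else 1) = (N - 1 + Real.exp c) ^ k := fun a => by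
    rw [← Fintype.prod_sum (f := fun g j => if a g = j then Real.exp c else 1)]
    simp [h2]
  simp_rw [h1, h3]
  simp

/-- Lower bound from correlating one variable with `k` others, one chosen from each of `k` groups
of size `N`. -/
theorem le_ellMinimaxRisk_of_star {n p k N : ℕ} (hn : 0 < n) (hN : 0 < N)
    (hkN : k * N + 1 ≤ p) {q r R δ : ℝ} (hq : 0 ≤ q) (hδ0 : 0 < δ) (hδ : δ ^ 2 ≤ 1 / 2)
    (hR : 1 + k * δ ^ q ≤ R) (hexp : k * (Real.exp (5 * n * δ ^ 2) - 1) / N ≤ 1 / 2) :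
    ENNReal.ofReal ((k * δ ^ r) ^ 2 / 32) ≤ ellMinimaxRisk n p q r R := by
  have hp : 0 < p := by omega
  have hδ1 : δ ≤ 1 := by nlinarith
  have hN' : (0 : ℝ) < N := by exact_mod_cast hN
  let i₀ : Fin p := ⟨0, hp⟩
  have hNe : Nonempty (Fin N) := ⟨⟨0, hN⟩⟩
  let ι : Fin k × Fin N → Fin p := fun x => ⟨finProdFinEquiv x + 1, by
    have := (finProdFinEquiv x).2; omega⟩
  have hι : Function.Injective ι := fun x y h => by
    have : (finProdFinEquiv x : ℕ) = finProdFinEquiv y := by simpa [ι] using h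
    exact finProdFinEquiv.injective (Fin.ext this)
  let S : (Fin k → Fin N) → Finset (Fin p) := fun a => Finset.univ.image fun g => ι (g, a g)
  have hinj : ∀ a : Fin k → Fin N, Function.Injective fun g => ι (g, a g) := fun a g g' h =>
    congrArg Prod.fst (hι h)
  have hS : ∀ a, i₀ ∉ S a := fun a h => by
    obtain ⟨g, -, hg⟩ := Finset.mem_image.1 h
    simp [ι, i₀, Fin.ext_iff] at hg
  have hcard : ∀ a, (S a).card = k := fun a => by
    rw [Finset.card_image_of_injective _ (hinj a)]; simp
  have hinter : ∀ a b, (S a ∩ S b).card = (Finset.univ.filter fun g => a g = b g).card := by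
    intro a b
    rw [← Finset.card_image_of_injective _ (hinj a)]
    congr 1
    ext x
    simp only [S, Finset.mem_inter, Finset.mem_image, Finset.mem_univ, true_and, Finset.mem_filter]
    constructor
    · rintro ⟨⟨g, rfl⟩, g', hg'⟩
      have h := hι hg'
      obtain rfl : g' = g := congrArg Prod.fst h
      exact ⟨g', (congrArg Prod.snd h).symm, rfl⟩
    · rintro ⟨g, hg, rfl⟩
      exact ⟨⟨g, rfl⟩, g, by rw [hg]⟩
  have hR1 : 1 ≤ R := le_trans (le_add_of_nonneg_right (by positivity)) hR
  refine le_ellMinimaxRisk_of_correlated hn hδ (starParents i₀) (starChildren i₀)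
    (fun _ : Fin k → Fin N => ()) S (fun _ _ _ => rfl) ?_ ?_ ?_ (ℓ := 1) (by positivity) ?_ ?_
  · simp_rw [hinter]
    rw [sum_exp_card_agree, Fintype.card_fun, Fintype.card_fin, Fintype.card_fin]
    have h1 : (N : ℝ) - 1 + Real.exp (5 * n * δ ^ 2) =
        N * (1 + (Real.exp (5 * n * δ ^ 2) - 1) / N) := by field_simp; ring
    have h0 : 0 ≤ (Real.exp (5 * n * δ ^ 2) - 1) / N :=
      div_nonneg (sub_nonneg.2 (Real.one_le_exp (by positivity))) hN'.le
    -- The left side is the normalized overlap moment: each of the `k` groups agrees with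
    -- probability `1 / N`.
    have h2 : (1 + (Real.exp (5 * n * δ ^ 2) - 1) / N) ^ k ≤ 2 := by
      calc _ ≤ Real.exp ((Real.exp (5 * n * δ ^ 2) - 1) / N) ^ k := by
            refine pow_le_pow_left₀ (by linarith) ?_ k
            rw [add_comm]
            exact Real.add_one_le_exp _
        _ = Real.exp (k * (Real.exp (5 * n * δ ^ 2) - 1) / N) := by
            rw [← Real.exp_nat_mul, mul_div_assoc]
        _ ≤ Real.exp (1 / 2) := Real.exp_le_exp.2 hexp
        _ ≤ 2 := by
            have h3 : Real.exp (1 / 2) ^ 2 = Real.exp 1 := by rw [← Real.exp_nat_mul]; norm_num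
            have h4 := Real.exp_one_lt_d9
            nlinarith [Real.exp_pos (1 / 2)]
    rw [h1, mul_pow]
    push_cast
    nlinarith [sq_nonneg ((N : ℝ) ^ k)]
  · rw [star_null]
    exact starCov_mem_rowSparseClass (by simp) one_pos le_rfl hq (by simpa using hR1)
  · intro a
    rw [correlatedCov_star δ (hS a)]
    exact starCov_mem_rowSparseClass (hS a) hδ0 hδ1 hq (by rwa [hcard])
  · rw [star_null]
    refine ellFunctional_le hp fun i => ?_
    refine le_of_eq ?_
    have : ∀ j, absPow r (starCov i₀ 1 ∅ i j) = if i = j then 1 else 0 := fun j => by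
      simp only [starCov, Matrix.of_apply, Finset.notMem_empty, if_false, ite_self, false_and]
      split_ifs
      · exact absPow_one r
      · exact absPow_zero r
    simp [this]
  · intro a
    rw [correlatedCov_star δ (hS a)]
    have := le_ellFunctional_starCov (r := r) (hS a) hδ0
    rwa [hcard] at this

/-! ### Choice of the parameters and the two rates. -/

/-- Ensures that a single off-diagonal entry of size up to `2 b` fits into the row budget even for
the smallest `R`. For `q = 0` such an entry costs `1`, hence `2 ≤ R₀`. -/
theorem exists_base_correlation {q R₀ : ℝ} (hR₀ : 1 < R₀) (hR₀q : q = 0 → 2 ≤ R₀) (hq : 0 ≤ q) :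
    ∃ b : ℝ, 0 < b ∧ b ≤ 1 / 2 ∧ (2 * b) ^ q ≤ R₀ - 1 := by
  have h0 : 0 < R₀ - 1 := by linarith
  rcases hq.eq_or_lt with rfl | hq
  · exact ⟨1 / 2, by norm_num, le_rfl, by have := hR₀q rfl; rw [Real.rpow_zero]; linarith⟩
  · have h1 := Real.rpow_pos_of_pos h0 q⁻¹
    refine ⟨min 1 ((R₀ - 1) ^ q⁻¹) / 2, by positivity, ?_, ?_⟩
    · have := min_le_left 1 ((R₀ - 1) ^ q⁻¹); linarith
    · rw [mul_div_cancel₀ _ two_ne_zero]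
      calc _ ≤ ((R₀ - 1) ^ q⁻¹) ^ q :=
            Real.rpow_le_rpow (by positivity) (min_le_right _ _) hq.le
        _ = R₀ - 1 := Real.rpow_inv_rpow h0.le hq.ne'

/-- `max 1 ⌊x⌋₊` is comparable to `max 1 x`. -/
theorem half_le_max_one_floor {x : ℝ} : x / 2 ≤ (max 1 ⌊x⌋₊ : ℕ) := by
  have h1 := Nat.lt_floor_add_one x
  have h2 : (1 : ℝ) ≤ (max 1 ⌊x⌋₊ : ℕ) := by exact_mod_cast le_max_left _ _
  have h3 : (⌊x⌋₊ : ℝ) ≤ (max 1 ⌊x⌋₊ : ℕ) := by exact_mod_cast le_max_right _ _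
  linarith

theorem max_one_floor_cases {x : ℝ} (hx : 0 ≤ x) :
    max 1 ⌊x⌋₊ = 1 ∨ ((max 1 ⌊x⌋₊ : ℕ) : ℝ) ≤ x := by
  rcases le_total ⌊x⌋₊ 1 with h | h
  · exact .inl (max_eq_left h)
  · right
    rw [max_eq_right h]
    exact Nat.floor_le hx

/-- A bound that serves convex and concave powers alike: `(x / y)^r ≥ 1 + r log (x / y) ≥ 1 + r (1 -
y / x)`, and `1 - y / x ≥ x - y` because `x ≤ 1`. -/
theorem rpow_sub_rpow_ge {x y r : ℝ} (hy : 0 < y) (hxy : y ≤ x) (hx : x ≤ 1) (hr : 0 ≤ r) :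
    r * y ^ r * (x - y) ≤ x ^ r - y ^ r := by
  have hx0 : 0 < x := hy.trans_le hxy
  have h1 : x ^ r = y ^ r * (x / y) ^ r := by
    rw [← Real.mul_rpow hy.le (by positivity), mul_div_cancel₀ _ hy.ne']
  have h2 : r * (x - y) + 1 ≤ (x / y) ^ r := by
    rw [Real.rpow_def_of_pos (by positivity)]
    refine le_trans ?_ (Real.add_one_le_exp _)
    have h3 := Real.one_sub_inv_le_log_of_pos (show 0 < x / y by positivity)
    have h4 : x - y ≤ 1 - (x / y)⁻¹ := by
      rw [inv_div, ← sub_nonneg]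
      have : 1 - y / x - (x - y) = (x - y) * (1 - x) / x := by field_simp
      rw [this]
      exact div_nonneg (mul_nonneg (by linarith) (by linarith)) hx0.le
    have := mul_le_mul_of_nonneg_left (h4.trans h3) hr
    linarith
  rw [h1]
  have := mul_le_mul_of_nonneg_left h2 (Real.rpow_pos_of_pos hy r).le
  linarith

theorem pos_of_two_mul_log_lt {n p : ℕ} (hlog : 2 * Real.log p < n) : 0 < n := by
  have h1 := Real.log_natCast_nonneg p
  have : (0 : ℝ) < n := by linarith
  exact_mod_cast this

theorem two_mul_sq_mul_rpow_lt {n p : ℕ} {q R : ℝ} (hn : 0 < n)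
    (hp : R ^ 2 < ((p : ℝ) - 1) * (n : ℝ) ^ (-q) / 2) : 2 * (R ^ 2 * (n : ℝ) ^ q) < p - 1 := by
  have hn' : (0 : ℝ) < n := by exact_mod_cast hn
  have h1 := Real.rpow_pos_of_pos hn' q
  rw [Real.rpow_neg hn'.le, lt_div_iff₀ two_pos, ← div_eq_mul_inv, lt_div_iff₀ h1] at hp
  linarith

set_option maxHeartbeats 400000 in
/-- The parametric part of the lower bound. -/
theorem exists_parametric_lower_bound {q r R₀ : ℝ} (hq : 0 ≤ q) (hqr : q < r) (hR₀ : 1 < R₀)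
    (hR₀q : q = 0 → 2 ≤ R₀) : ∃ c : ℝ, 0 < c ∧ ∀ (n p : ℕ) (R : ℝ), R₀ ≤ R →
      2 * Real.log p < n → R ^ 2 < ((p : ℝ) - 1) * (n : ℝ) ^ (-q) / 2 →
        ENNReal.ofReal (c * (R ^ 2 * (Real.log p / n))) ≤ ellMinimaxRisk n p q r R := by
  obtain ⟨b, hb0, hb1, hbq⟩ := exists_base_correlation hR₀ hR₀q hq
  have hr : 0 < r := hq.trans_lt hqr
  have hbr := Real.rpow_pos_of_pos hb0 r
  refine ⟨r ^ 2 * (b ^ r) ^ 2 * b ^ 2 / 8192, by positivity, fun n p R hR hlog hp => ?_⟩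
  have hn := pos_of_two_mul_log_lt hlog
  have hn' : (0 : ℝ) < n := by exact_mod_cast hn
  have hpn := two_mul_sq_mul_rpow_lt hn hp
  have hnq : 1 ≤ (n : ℝ) ^ q := Real.one_le_rpow (by exact_mod_cast hn) hq
  have hpR : 2 * R ^ 2 + 1 < p := by
    linarith [le_mul_of_one_le_right (sq_nonneg R) hnq]
  have hlog0 := Real.log_natCast_nonneg p
  set m := max 1 ⌊R / 2⌋₊ with hm
  have hm0 : 0 < m := lt_of_lt_of_le one_pos (le_max_left _ _)
  have hmR : R / 4 ≤ m := by have := half_le_max_one_floor (x := R / 2); linarith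
  set M := p / (2 * m) with hMdef
  have hp4 : 4 ≤ p := by
    have : (3 : ℝ) < p := by nlinarith only [hpR, hR, hR₀]
    exact_mod_cast this
  have hdiv : p < (M + 1) * (2 * m) := by
    rw [mul_comm]; exact Nat.lt_mul_div_succ p (by omega)
  -- There are at least of order `√p` blocks: if `m ≤ R / 2` then `p < (M + 1) R`, while `R² < p /
  -- 2`. Hence `p ≤ M³`, and `log M` is of order `log p`.
  have hM : 2 ≤ M ∧ p ≤ 2 * M ^ 2 := by
    rcases max_one_floor_cases (x := R / 2) (by linarith) with h | h
    · rw [← hm] at h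
      rw [h] at hdiv
      have h2 : 2 ≤ M := by rw [hMdef, h]; omega
      exact ⟨h2, by nlinarith only [h2, hdiv]⟩
    · rw [← hm] at h
      have hm1 : (1 : ℝ) ≤ m := by exact_mod_cast hm0
      have hdiv' : (p : ℝ) < (M + 1) * (2 * m) := by exact_mod_cast hdiv
      have h2 : 2 ≤ M := by
        rw [hMdef, Nat.le_div_iff_mul_le (by omega)]
        have : (2 * (2 * m) : ℝ) ≤ p := by nlinarith only [h, hm1, hpR]
        exact_mod_cast this
      refine ⟨h2, ?_⟩
      have hM2 : (2 : ℝ) ≤ M := by exact_mod_cast h2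
      have h3 : (p : ℝ) < (M + 1) * R := by nlinarith only [hdiv', h, hM2]
      have h4 : (p : ℝ) * p < (M + 1) ^ 2 * (p / 2) := by
        have : (p : ℝ) * p < ((M + 1) * R) * ((M + 1) * R) := by
          apply mul_self_lt_mul_self <;> linarith [(Nat.cast_nonneg p : (0 : ℝ) ≤ p)]
        have h5 : (M + 1 : ℝ) ^ 2 * R ^ 2 ≤ (M + 1) ^ 2 * (p / 2) := by gcongr; linarith
        linarith [show ((M : ℝ) + 1) * R * ((M + 1) * R) = (M + 1) ^ 2 * R ^ 2 by ring]
      have hp0 : (0 : ℝ) < p := by linarith [sq_nonneg R]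
      have h5 : (p : ℝ) < (M + 1) ^ 2 / 2 := by nlinarith only [h4, hp0]
      have : (p : ℝ) ≤ 2 * M ^ 2 := by nlinarith only [h5, hM2]
      exact_mod_cast this
  have hlogM : Real.log p ≤ 3 * Real.log M := by
    have h1 : p ≤ M ^ 3 := by
      refine hM.2.trans ?_
      rw [pow_succ M 2, mul_comm]
      exact Nat.mul_le_mul_left _ hM.1
    have h2 : (p : ℝ) ≤ (M : ℝ) ^ 3 := by exact_mod_cast h1
    have h3 := Real.log_le_log (by linarith [sq_nonneg R]) h2
    rw [Real.log_pow] at h3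
    exact_mod_cast h3
  have hMpos : (0 : ℝ) < M := by exact_mod_cast lt_of_lt_of_le two_pos hM.1
  -- The factor `b` keeps the raised correlation below `2 b`, and makes `5 n δ² = (5/4) b² log p ≤
  -- (15/16) log M`.
  set δ := b * √(Real.log p / (4 * n)) with hδdef
  have hL0 : 0 ≤ Real.log p / (4 * n) := by positivity
  have hL1 : Real.log p / (4 * n) ≤ 1 / 8 := by
    rw [div_le_iff₀ (by positivity)]; linarith
  have hδ0 : 0 ≤ δ := by positivity
  have hδsq : δ ^ 2 = b ^ 2 * (Real.log p / (4 * n)) := by rw [hδdef, mul_pow, Real.sq_sqrt hL0]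
  have hδb : δ ≤ b := by
    rw [hδdef]
    refine mul_le_of_le_one_right hb0.le ?_
    rw [Real.sqrt_le_one]
    linarith
  have hρ : b + (1 - b) * δ ≤ 2 * b := by nlinarith only [hδ0, hδb, hb0]
  have hρ0 : 0 ≤ (1 - b) * δ := mul_nonneg (by linarith) hδ0
  have hρq : (b + (1 - b) * δ) ^ q ≤ (2 * b) ^ q := Real.rpow_le_rpow (by linarith) hρ hq
  have hmain := le_ellMinimaxRisk_of_pairs (n := n) (p := p) (m := m) (q := q) (r := r) (R := R)
    (b := b) (δ := δ) hn hm0 hq hr.le hb0 (by linarith) hδ0 (by nlinarith only [hδ0, hδb, hb1]) ?_ (by omega) ?_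
  · refine le_trans (ENNReal.ofReal_le_ofReal ?_) hmain
    have hgap := rpow_sub_rpow_ge hb0 (show b ≤ b + (1 - b) * δ by linarith) (by linarith) hr.le
    have h1 : R / 4 * (r * b ^ r * (1 / 2 * δ)) ≤ m * ((b + (1 - b) * δ) ^ r - b ^ r) := by
      have h2 : r * b ^ r * (1 / 2 * δ) ≤ r * b ^ r * (b + (1 - b) * δ - b) := by
        refine mul_le_mul_of_nonneg_left ?_ (by positivity)
        nlinarith only [hδ0, hb1]
      refine mul_le_mul hmR (h2.trans hgap) (by positivity) (by positivity)
    have h3 := pow_le_pow_left₀ (by have : 0 ≤ R := by linarith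
                                    positivity) h1 2
    refine le_trans (le_of_eq ?_) (div_le_div_of_nonneg_right h3 (by norm_num))
    have h4 : (R / 4 * (r * b ^ r * (1 / 2 * δ))) ^ 2 = R ^ 2 / 64 * (r ^ 2 * (b ^ r) ^ 2) * δ ^ 2 := by
      ring
    rw [h4, hδsq]
    field_simp
    ring
  · rcases max_one_floor_cases (x := R / 2) (by linarith) with h | h
    · rw [← hm] at h
      rw [h, Nat.cast_one, one_mul]
      linarith
    · rw [← hm] at h
      have h1 : (2 * b) ^ q ≤ 1 := Real.rpow_le_one (by linarith) (by linarith) hq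
      have h2 : (m : ℝ) * (1 + (b + (1 - b) * δ) ^ q) ≤ m * 2 :=
        mul_le_mul_of_nonneg_left (by linarith) (Nat.cast_nonneg _)
      linarith
  · have h1 : 5 * n * δ ^ 2 ≤ Real.log M := by
      rw [hδsq]
      have : 5 * n * (b ^ 2 * (Real.log p / (4 * n))) = 5 / 4 * b ^ 2 * Real.log p := by
        field_simp
      rw [this]
      have hb2 : b ^ 2 ≤ 1 / 4 := by nlinarith only [hb0, hb1]
      nlinarith only [hb2, hlog0, hlogM]
    rwa [Real.le_log_iff_exp_le hMpos] at h1

set_option maxHeartbeats 400000 in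
/-- The nonparametric part of the lower bound. -/
theorem exists_sparse_lower_bound {q r R₀ : ℝ} (hq : 0 ≤ q) (hR₀ : 1 < R₀)
    (hR₀q : q = 0 → 2 ≤ R₀) : ∃ c : ℝ, 0 < c ∧ ∀ (n p : ℕ) (R : ℝ), R₀ ≤ R →
      2 * Real.log p < n → R ^ 2 < ((p : ℝ) - 1) * (n : ℝ) ^ (-q) / 2 →
        ENNReal.ofReal (c * (R ^ 2 *
          (Real.log (((p : ℝ) - 1) / (R ^ 2 * (n : ℝ) ^ q) + 1) / (2 * n)) ^ (r - q))) ≤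
            ellMinimaxRisk n p q r R := by
  obtain ⟨b, hb0, hb1, hbq⟩ := exists_base_correlation hR₀ hR₀q hq
  have hR0pos : 0 < R₀ := by linarith
  -- `κ` makes `δ = √(κ τ) ≤ 2 b` and `5 κ / 2 ≤ 1/4`. Below, `θ` gives `θ R ≤ R - 1` for `R ≥ R₀`,
  -- and the factor `2^(-q/2)` in `η` absorbs the `2^q` of `(2 n)^q`.
  set κ := b ^ 2 / 10 with hκ
  have hκ0 : 0 < κ := by positivity
  have hκ1 : κ ≤ 1 / 10 := by rw [hκ]; nlinarith only [hb0, hb1]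
  set θ := 1 - R₀⁻¹ with hθ
  have hθ0 : 0 < θ := by rw [hθ, sub_pos]; exact inv_lt_one_of_one_lt₀ hR₀
  have hθ1 : θ ≤ 1 := by rw [hθ]; linarith [inv_pos.2 hR0pos]
  set η := θ * 2 ^ (-q / 2) with hη
  have h2q : (0 : ℝ) < 2 ^ (-q / 2) := by positivity
  have h2q1 : (2 : ℝ) ^ (-q / 2) ≤ 1 := Real.rpow_le_one_of_one_le_of_nonpos one_le_two (by linarith)
  have h2qsq : ((2 : ℝ) ^ (-q / 2)) ^ 2 * 2 ^ q = 1 := by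
    rw [← Real.rpow_natCast, ← Real.rpow_mul two_pos.le, ← Real.rpow_add two_pos]
    norm_num
  have hη0 : 0 < η := by positivity
  have hηθ : η ≤ θ := mul_le_of_le_one_right hθ0.le h2q1
  have hη2 : η ^ 2 * 2 ^ q ≤ 1 := by
    rw [hη, mul_pow, mul_assoc, h2qsq, mul_one]
    nlinarith only [hθ0, hθ1]
  clear_value η θ κ
  refine ⟨η ^ 2 * κ ^ r / 128, by positivity, fun n p R hR hlog hp => ?_⟩
  have hn := pos_of_two_mul_log_lt hlog
  have hn' : (0 : ℝ) < n := by exact_mod_cast hn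
  have hpn := two_mul_sq_mul_rpow_lt hn hp
  have hnq : 1 ≤ (n : ℝ) ^ q := Real.one_le_rpow (by exact_mod_cast hn) hq
  have hRpos : 0 < R := by linarith
  set D := R ^ 2 * (n : ℝ) ^ q with hD
  have hD1 : 1 ≤ D := by rw [hD]; nlinarith only [hnq, hR, hR₀, sq_nonneg (R - 1)]
  set u := ((p : ℝ) - 1) / D with hu
  have huD : u * D = p - 1 := div_mul_cancel₀ _ (by linarith)
  have hu2 : 2 < u := by rw [hu, lt_div_iff₀ (by linarith)]; linarith
  have hup : u + 1 ≤ p := by nlinarith only [huD, hu2, hD1]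
  set τ := Real.log (u + 1) / (2 * n) with hτ
  have hlogu : 1 ≤ Real.log (u + 1) := by
    rw [Real.le_log_iff_exp_le (by linarith)]
    linarith [Real.exp_one_lt_d9]
  have hτ0 : 0 < τ := by positivity
  have hτ1 : τ ≤ 1 / 4 := by
    rw [hτ, div_le_iff₀ (by positivity)]
    have := Real.log_le_log (by linarith) hup
    linarith
  have hτn : τ ^ (-q) ≤ (2 * n) ^ q := by
    rw [Real.rpow_neg hτ0.le, ← Real.inv_rpow hτ0.le]
    refine Real.rpow_le_rpow (by positivity) ?_ hq
    rw [hτ, inv_div]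
    exact div_le_self (by positivity) hlogu
  set X := η * R * τ ^ (-q / 2) with hX
  have hτq : (0 : ℝ) < τ ^ (-q / 2) := by positivity
  have hX0 : 0 ≤ X := by positivity
  have hXsq : X ^ 2 = η ^ 2 * R ^ 2 * τ ^ (-q) := by
    rw [hX, mul_pow, mul_pow, ← Real.rpow_natCast (τ ^ (-q / 2)), ← Real.rpow_mul hτ0.le]
    norm_num
  set k := max 1 ⌊X⌋₊ with hk
  have hk0 : 1 ≤ k := le_max_left _ _
  have hk1 : (1 : ℝ) ≤ k := by exact_mod_cast hk0
  have hkX : X / 2 ≤ k := half_le_max_one_floor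
  clear_value k
  set δ := √(κ * τ) with hδ
  have hδsq : δ ^ 2 = κ * τ := Real.sq_sqrt (by positivity)
  have hδ0 : 0 < δ := Real.sqrt_pos.2 (by positivity)
  have hδb : δ ≤ 2 * b := by
    rw [hδ, Real.sqrt_le_iff]
    exact ⟨by linarith, by rw [hκ]; nlinarith only [hτ1, hb0]⟩
  -- Since `log (u + 1) ≥ 1`, `τ⁻¹ ≤ 2 n`, so `X² ≤ R² n^q = D`. This makes the group size `N` at
  -- least of order `k u`, which controls the overlaps.
  have hku : (k : ℝ) ^ 2 * u ≤ p - 1 := by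
    rcases max_one_floor_cases hX0 with h | h
    · rw [← hk] at h
      rw [h]; norm_num; linarith
    · rw [← hk] at h
      rw [← huD, mul_comm]
      refine mul_le_mul_of_nonneg_left ?_ (by linarith)
      calc (k : ℝ) ^ 2 ≤ X ^ 2 := pow_le_pow_left₀ (by linarith) h 2
        _ ≤ η ^ 2 * R ^ 2 * (2 * n) ^ q := by rw [hXsq]; gcongr
        _ = (η ^ 2 * 2 ^ q) * D := by rw [Real.mul_rpow two_pos.le hn'.le, hD]; ring
        _ ≤ D := mul_le_of_le_one_left (by linarith) hη2
  set N := (p - 1) / k with hN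
  have hp1 : 1 ≤ p := by
    have : (1 : ℝ) ≤ p := by linarith
    exact_mod_cast this
  have hdiv : (p : ℝ) - 1 < (N + 1) * k := by
    have : p - 1 < (N + 1) * k := by rw [mul_comm]; exact Nat.lt_mul_div_succ _ (by omega)
    have h2 : ((p - 1 : ℕ) : ℝ) < (N + 1) * k := by exact_mod_cast this
    rwa [Nat.cast_sub hp1, Nat.cast_one] at h2
  have hNku : k * u < N + 1 := by
    refine lt_of_mul_lt_mul_right (a := (k : ℝ)) ?_ (by linarith)
    linarith [hku, hdiv, show (k : ℝ) ^ 2 * u = k * u * k by ring]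
  have hN1 : 1 ≤ N := by
    have h1 : u ≤ k * u := le_mul_of_one_le_left (by linarith) hk1
    have : (0 : ℝ) < N := by linarith
    exact_mod_cast this
  have hNr : (1 : ℝ) ≤ N := by exact_mod_cast hN1
  clear_value N δ
  have hmain := le_ellMinimaxRisk_of_star (n := n) (p := p) (k := k) (N := N) (q := q) (r := r)
    (R := R) (δ := δ) hn hN1 (by rw [hN]; have := Nat.mul_div_le (p - 1) k; omega) hq hδ0
    (by rw [hδsq]; nlinarith only [hκ0, hκ1, hτ0, hτ1]) ?_ ?_
  · refine le_trans (ENNReal.ofReal_le_ofReal ?_) hmain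
    have h1 : (δ ^ r) ^ 2 = κ ^ r * τ ^ r := by
      rw [← Real.mul_rpow hκ0.le hτ0.le, ← hδsq, ← Real.rpow_natCast (δ ^ r),
        ← Real.rpow_natCast δ, ← Real.rpow_mul hδ0.le, ← Real.rpow_mul hδ0.le, mul_comm]
    have h2 : τ ^ (r - q) = τ ^ r * τ ^ (-q) := by rw [← Real.rpow_add hτ0, sub_eq_add_neg]
    have h3 : X ^ 2 / 4 ≤ (k : ℝ) ^ 2 := by
      have := pow_le_pow_left₀ (by positivity) hkX 2
      linarith [this, show (X / 2) ^ 2 = X ^ 2 / 4 by ring]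
    rw [mul_pow (k : ℝ), h1, h2]
    calc _ = X ^ 2 / 4 * (κ ^ r * τ ^ r) / 32 := by rw [hXsq]; ring
      _ ≤ _ := by gcongr
  · rcases max_one_floor_cases hX0 with h | h
    · rw [← hk] at h
      rw [h, Nat.cast_one, one_mul]
      have := Real.rpow_le_rpow hδ0.le hδb hq
      linarith
    · rw [← hk] at h
      have h1 : δ ^ q ≤ τ ^ (q / 2) := by
        have h2 : δ ≤ √τ := hδ ▸ Real.sqrt_le_sqrt (by nlinarith only [hκ1, hτ0])
        refine (Real.rpow_le_rpow hδ0.le h2 hq).trans_eq ?_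
        rw [Real.sqrt_eq_rpow, ← Real.rpow_mul hτ0.le]
        congr 1
        ring
      have h3 : τ ^ (-q / 2) * τ ^ (q / 2) = 1 := by
        rw [← Real.rpow_add hτ0, neg_div, neg_add_cancel, Real.rpow_zero]
      have h4 : (k : ℝ) * δ ^ q ≤ η * R := by
        calc _ ≤ X * τ ^ (q / 2) := by gcongr
          _ = η * R * (τ ^ (-q / 2) * τ ^ (q / 2)) := by rw [hX]; ring
          _ = η * R := by rw [h3, mul_one]
      have h5 : 1 ≤ R₀⁻¹ * R := by
        rw [inv_mul_eq_div, le_div_iff₀ hR0pos]; linarith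
      have h6 : η * R ≤ θ * R := by gcongr
      rw [hθ] at h6
      linarith
  · have hexp : Real.exp (5 * n * δ ^ 2) - 1 ≤ u / 4 := by
      have h1 : 5 * n * δ ^ 2 = Real.log (1 + u) * (5 * κ / 2) := by
        rw [hδsq, hτ, add_comm 1 u]; field_simp
      rw [h1, ← Real.rpow_def_of_pos (by linarith)]
      -- Bernoulli's inequality for the exponent `5 κ / 2 ≤ 1`. With `k u < N + 1 ≤ 2 N` the overlap
      -- condition follows.
      have h2 := rpow_one_add_le_one_add_mul_self (show -1 ≤ u by linarith)
        (show 0 ≤ 5 * κ / 2 by positivity) (by linarith)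
      nlinarith only [h2, hκ1, hu2]
    rw [div_le_iff₀ (by linarith)]
    have h3 : k * (Real.exp (5 * n * δ ^ 2) - 1) ≤ k * (u / 4) := by gcongr
    linarith

end

/-! ### Combination of the two bounds. -/

theorem theorem4p1 (q r : ℝ) (hq : 0 ≤ q) (hqr : q < r)
    (R₀ : ℝ) (hR₀ : 1 < R₀) (hR₀q : q = 0 → 2 ≤ R₀) :
    ∃ C₄ : ℝ, 0 < C₄ ∧ ∀ (n p : ℕ) (R : ℝ), R₀ ≤ R →
      2 * Real.log p < n → R ^ 2 < ((p : ℝ) - 1) * (n : ℝ) ^ (-q) / 2 →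
        ENNReal.ofReal (C₄ * ellRate n p q r R) ≤ ellMinimaxRisk n p q r R := by
  obtain ⟨c₁, hc₁, h₁⟩ := exists_parametric_lower_bound hq hqr hR₀ hR₀q
  obtain ⟨c₂, hc₂, h₂⟩ := exists_sparse_lower_bound (r := r) hq hR₀ hR₀q
  refine ⟨min c₁ c₂, lt_min hc₁ hc₂, fun n p R hR hlog hp => ?_⟩
  have hn := pos_of_two_mul_log_lt hlog
  have hpn := two_mul_sq_mul_rpow_lt hn hp
  have hp1 : (1 : ℝ) ≤ p := by
    have : 0 ≤ R ^ 2 * (n : ℝ) ^ q := by positivity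
    linarith
  unfold ellRate
  rcases max_choice (R ^ 2 * (Real.log p / n)) (min (min
      (R ^ 2 * (Real.log (((p : ℝ) - 1) / (R ^ 2 * (n : ℝ) ^ q) + 1) / (2 * n)) ^ (r - q))
      (R ^ (2 * r / q))) 1) with h | h <;> rw [h]
  · refine le_trans (ENNReal.ofReal_le_ofReal ?_) (h₁ n p R hR hlog hp)
    have := Real.log_natCast_nonneg p
    exact mul_le_mul_of_nonneg_right (min_le_left _ _) (by positivity)
  · refine le_trans (ENNReal.ofReal_le_ofReal ?_) (h₂ n p R hR hlog hp)
    have hlog0 : 0 ≤ Real.log (((p : ℝ) - 1) / (R ^ 2 * (n : ℝ) ^ q) + 1) := by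
      refine Real.log_nonneg ?_
      have : 0 ≤ ((p : ℝ) - 1) / (R ^ 2 * (n : ℝ) ^ q) := div_nonneg (by linarith) (by positivity)
      linarith
    -- The sparse bound holds without the caps `R^(2r/q)` and `1`, which are simply dropped.
    refine (mul_le_mul_of_nonneg_left ((min_le_left _ _).trans (min_le_left _ _))
      (lt_min hc₁ hc₂).le).trans ?_
    exact mul_le_mul_of_nonneg_right (min_le_right _ _) (by positivity)
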